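/- **Definitions.** An *almost Dedekind domain* is an integral domain $D$ such that $D_M$ is a discrete valuation ring for every maximal ideal $M$ of $D$. A maximal ideal $M$ of a domain is *critical* if it contains no nonzero finitely generated radical ideal; $\mathrm{Crit}(D)$ is the set of critical maximal ideals. Let $K$ be the quotient field of $D$. By transfinite recursion put $\mathrm{Crit}^0(D)=\mathrm{Max}(D)$, $T_\beta=\bigcap\{D_M\mid M\in\mathrm{Crit}^\beta(D)\}$ (an overring of $D$ in $K$, equal to $K$ if $\mathrm{Crit}^\beta(D)=\emptyset$), $\mathrm{Crit}^{\beta+1}(D)=\{P\in\mathrm{Max}(D)\mid PT_\beta\in\mathrm{Crit}(T_\beta)\}$, and $\mathrm{Crit}^\beta(D)=\bigcap_{\gamma<\beta}\mathrm{Crit}^\gamma(D)$ for $\beta$ a limit ordinal. The *SP-rank* of $D$ is the smallest ordinal $\beta$ with $\mathrm{Crit}^\beta(D)=\emptyset$. **Construction.** Let $\alpha\geq 1$ be an ordinal, $\xi=\max\{\omega,\alpha\}$ and $F$ a field. Limit ordinals are understood to be nonzero. Consider sequences $t=(t_\gamma)_{0<\gamma<\alpha}$ of ordinals $t_\gamma<\xi$.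 Let $e_\beta$ be the sequence with $\beta$-th component $1$ and all other components $0$, and let $\tau_\beta(t)$ be obtained from $t$ by replacing all components $t_\gamma$ with $\gamma\leq\beta$ by $0$. For $\beta<\alpha$ let $U_\beta$ be the set of all such $t$ with only finitely many nonzero components, with $t_\gamma<\omega$ for every successor ordinal $\gamma<\alpha$, with $t_\delta=0$ for all $0<\delta<\beta$, and, if $\beta$ is a limit ordinal, with $t_\beta<\beta$. Let $\mathcal T$ be the directed graph with vertices $X_{\beta,t}$ ($\beta<\alpha$, $t\in U_\beta$; $\beta$ is the height) and with the edges * $(X_{\gamma+1,t},\,X_{\gamma,t+ke_{\gamma+1}})$ for $\gamma+1<\alpha$, $t\in U_{\gamma+1}$ and integers $k\geq1$; * $(X_{\beta,t},\,X_{\gamma,\tau_\beta(t)})$ for limit ordinals $\beta<\alpha$, $t\in U_\beta$ and successor ordinals $\gamma$ with $t_\beta<\gamma<\beta$. Regard the $X_{0,t}$, $t\in U_0$, as independent indeterminates over $F$, and put recursively $X=\prod_{(X,Y)\in\mathcal T}Y^2$ for every vertex $X$ of positive height, a (possibly infinite) monomial $\prod_{r\in U_0}X_{0,r}^{n_r}$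 with $n_r\in\mathbb N_0$. A *monomial* is a finite product of vertices (the empty product $1$ included); the monomials form a monoid under multiplication of such infinite products, and $F[\mathbf X]$ is its monoid algebra over $F$. Let $S$ be the set of elements of $F[\mathbf X]$ that are not divisible in $F[\mathbf X]$ by any monomial other than $1$, and let $D=S^{-1}F[\mathbf X]$. Let $M_{0,t}=X_{0,t}D$; let $M_{\beta,t}$ be the ideal of $D$ generated by all $X_{\beta,\tau_\beta(t)+ie_\beta}$ with $i\in\mathbb N_0$ if $\beta$ is a successor ordinal, and by all $X_{\beta,\tau_\beta(t)+\gamma e_\beta}$ with $\gamma<\beta$ if $\beta$ is a limit ordinal. **Theorem.** For every ordinal $\alpha\geq1$ and every field $F$, the set $S$ is multiplicatively closed (and contains $1$), and $D=S^{-1}F[\mathbf X]$ is an almost Dedekind domain of SP-rank exactly $\alpha$. Moreover, for every ordinal $\beta\geq1$, $$\mathrm{Crit}^\beta(D)=\{M_{\gamma,t}\mid \beta\leq\gamma<\alpha,\ t\in U_\gamma\}.$$ **Corollary.** Every ordinal $\alpha\geq1$ is the SP-rank of some almost Dedekind domain. -/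

import Mathlib

universe u v

noncomputable section

open Ordinal

namespace AlmostDedekind

/- ### Almost Dedekind domains, critical ideals and the SP-rank -/

section Ring

variable (D : Type u) [CommRing D]

/-- An almost Dedekind domain: an integral domain all of whose localizations at maximal ideals are
discrete valuation rings (in particular `D` is not a field). -/
def IsAlmostDedekindDomain : Prop :=
  ∃ _ : IsDomain D, ∀ (M : Ideal D) [M.IsMaximal],
    IsDiscreteValuationRing (Localization.AtPrime M)

variable {D}

/-- A maximal ideal is critical if it contains no nonzero finitely generated radical ideal. -/
def IsCritical (M : Ideal D) : Prop :=
  M.IsMaximal ∧ ∀ I : Ideal D, I ≤ M → I ≠ ⊥ → I.FG → ¬ I.IsRadical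

/-- The localization `D_M`, as a subring of the quotient field of `D`:
the fractions `x = a / s` with `s ∉ M`. -/
def localizationAt (M : MaximalSpectrum D) : Subalgebra D (FractionRing D) where
  carrier := {x | ∃ a s : D, s ∉ M.asIdeal ∧
    x * algebraMap D (FractionRing D) s = algebraMap D (FractionRing D) a}
  mul_mem' := by
    rintro x y ⟨a, s, hs, hx⟩ ⟨b, t, ht, hy⟩
    refine ⟨a * b, s * t, fun h => ?_, ?_⟩
    · exact (M.isMaximal.isPrime.mem_or_mem h).elim hs ht
    · rw [map_mul, map_mul, ← hx, ← hy]; ring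
  add_mem' := by
    rintro x y ⟨a, s, hs, hx⟩ ⟨b, t, ht, hy⟩
    refine ⟨a * t + b * s, s * t, fun h => ?_, ?_⟩
    · exact (M.isMaximal.isPrime.mem_or_mem h).elim hs ht
    · rw [map_add, map_mul, map_mul, map_mul, ← hx, ← hy]; ring
  algebraMap_mem' r :=
    ⟨r, 1, fun h => M.isMaximal.ne_top ((Ideal.eq_top_iff_one _).2 h), by simp⟩

/-- The overring `⋂ {D_M | M ∈ C}` of `D` (the whole quotient field if `C` is empty). -/
def overring (C : Set (MaximalSpectrum D)) : Subalgebra D (FractionRing D) :=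
  ⨅ M ∈ C, localizationAt M

variable (D)

/-- The set `Crit^β(D)`, by transfinite recursion on `β`: all maximal ideals for `β = 0`; those `P`
for which `P T_γ` is a critical maximal ideal of `T_γ = ⋂ {D_M | M ∈ Crit^γ(D)}` for
`β = γ + 1`; and the intersection of the previous sets for a limit ordinal `β`. -/
def critSet (β : Ordinal.{v}) : Set (MaximalSpectrum D) :=
  Ordinal.limitRecOn β
    Set.univ
    (fun _ C => {P | IsCritical (P.asIdeal.map (algebraMap D (overring C)))})
    (fun β _ C => ⋂ (γ : Ordinal.{v}) (h : γ < β), C γ h)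

/-- `α` is the SP-rank of `D`: the smallest ordinal with `Crit^α(D) = ∅`. -/
def IsSPRank (α : Ordinal.{v}) : Prop :=
  IsLeast {β : Ordinal.{v} | critSet D β = ∅} α

end Ring

/- ### The graph -/

/-- Successor ordinals. -/
def IsSuccOrd (β : Ordinal.{u}) : Prop := ∃ γ : Ordinal.{u}, β = γ + 1

/-- `τ_β` keeps the components of index `> β` and replaces all others by zero. -/
def tau (β : Ordinal.{u}) (t : Ordinal.{u} →₀ Ordinal.{u}) : Ordinal.{u} →₀ Ordinal.{u} := by
  classical exact t.filter (fun γ => β < γ)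

/-- The index set `U_β`. A sequence indexed by the ordinals `0 < γ < α` with finitely many
nonzero components is encoded as a finitely supported function on the ordinals that vanishes
outside of that range. The components are smaller than `ξ = max ω α`. -/
def U (α β : Ordinal.{u}) : Set (Ordinal.{u} →₀ Ordinal.{u}) :=
  {t | (∀ γ, t γ ≠ 0 → 0 < γ ∧ γ < α) ∧
    (∀ γ, t γ < max ω α) ∧
    (∀ γ, IsSuccOrd γ → t γ < ω) ∧
    (∀ δ, δ < β → t δ = 0) ∧
    (Order.IsSuccLimit β → t β < β)}

/-- The vertices `X_{β,t}` with `β < α` and `t ∈ U_β`. -/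
@[ext]
structure Vertex (α : Ordinal.{u}) where
  /-- the height `β` -/
  height : Ordinal.{u}
  /-- the sequence `t` -/
  seq : Ordinal.{u} →₀ Ordinal.{u}
  height_lt : height < α
  seq_mem : seq ∈ U α height

/-- The edges: `(X_{γ+1,t}, X_{γ,t+k e_{γ+1}})` for `k ≥ 1`, and, for `β` limit,
`(X_{β,t}, X_{γ,τ_β(t)})` for every successor ordinal `γ` with `t_β < γ < β`. -/
def Edge {α : Ordinal.{u}} (v w : Vertex α) : Prop :=
  (v.height = w.height + 1 ∧
    ∃ k : ℕ, 1 ≤ k ∧ w.seq = v.seq + Finsupp.single v.height (k : Ordinal.{u})) ∨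
  (Order.IsSuccLimit v.height ∧ IsSuccOrd w.height ∧ v.seq v.height < w.height ∧
    w.height < v.height ∧ w.seq = tau v.height v.seq)

theorem Edge.height_lt {α : Ordinal.{u}} {v w : Vertex α} (h : Edge v w) :
    w.height < v.height := by
  rcases h with ⟨h, -⟩ | ⟨-, -, -, h, -⟩
  · rw [h]; exact lt_add_one _
  · exact h

/- ### The domain `F[X]` and its localization -/

/-- The exponents of `X_{β,t}` as a (possibly infinite) monomial `∏ X_{0,r} ^ n_r` in the
independent indeterminates `X_{0,r}`, `r ∈ U_0`. It is determined by `X = ∏ Y ^ 2`, the product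
over all edges `(X, Y)`, if `X` has positive height. For every `r`, at most one of the factors
involves `X_{0,r}`, so that the sum of exponents below has at most one nonzero term. -/
def expo {α : Ordinal.{u}} (v : Vertex α) (r : U α 0) : ℕ := by
  classical exact
    if v.height = 0 then (if v.seq = r then 1 else 0)
    else ∑ᶠ w : {w : Vertex α // Edge v w}, 2 * expo w.1 r
termination_by v.height
decreasing_by exact w.2.height_lt

/-- The monoid of monomials: finite products of elements of `X`. It is written additively, through
exponents. -/
def Mon (α : Ordinal.{u}) : AddSubmonoid (U α 0 → ℕ) :=
  AddSubmonoid.closure (Set.range fun v : Vertex α => expo v)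

/-- The domain `F[X]`: the monoid algebra over `F` of the monoid generated by `X`. -/
abbrev FX (α : Ordinal.{u}) (F : Type v) [Field F] : Type (max (u + 1) v) :=
  AddMonoidAlgebra F (Mon α)

section Domain

variable (α : Ordinal.{u}) (F : Type v) [Field F]

/-- A monomial, as an element of `F[X]`. -/
def monomial (m : Mon α) : FX α F := AddMonoidAlgebra.single m 1

/-- The elements of `F[X]` that are not divisible by a proper monomial
(a monomial other than `1`). -/
def S : Set (FX α F) := {f | ∀ m : Mon α, m ≠ 0 → ¬ monomial α F m ∣ f}

/-- The ring `S⁻¹ F[X]`. -/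
abbrev Dom : Type (max (u + 1) v) := Localization (Submonoid.closure (S α F))

variable {α}

/-- The element `X_{β,t}` of `D = S⁻¹ F[X]`. -/
def X (v : Vertex α) : Dom α F :=
  algebraMap (FX α F) (Dom α F)
    (monomial α F ⟨expo v, AddSubmonoid.subset_closure (Set.mem_range_self v)⟩)

/-- The ideal `M_{β,t}` of `D`, generated by `X_{0,t}` if `β = 0`, by all
`X_{β, τ_β(t) + i e_β}` with `i` a natural number if `β` is a successor, and by all
`X_{β, τ_β(t) + γ e_β}` with `γ < β` if `β` is a limit. -/
def maxIdeal (v : Vertex α) : Ideal (Dom α F) :=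
  Ideal.span {x | ∃ w : Vertex α, x = X F w ∧ w.height = v.height ∧
    ((v.height = 0 ∧ w.seq = v.seq) ∨
     (IsSuccOrd v.height ∧ ∃ i : ℕ,
        w.seq = tau v.height v.seq + Finsupp.single v.height (i : Ordinal.{u})) ∨
     (Order.IsSuccLimit v.height ∧ ∃ γ : Ordinal.{u}, γ < v.height ∧
        w.seq = tau v.height v.seq + Finsupp.single v.height γ))}

end Domain

end AlmostDedekind

end

universe w

noncomputable section

open Ordinal

namespace AlmostDedekind

/- ### Vertices and their supports -/

section Graph

variable {α : Ordinal.{u}}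

/-! The proof turns divisibility in `D` into the combinatorics of exponent functions. Say that two
vertices lie at the same point if they have the same height and their sequences agree above it
(`SamePt`). Raising the component at the height only deletes children, so the vertices at a point
form a chain of restrictions of one another (`SamePt.expo_eq`), like a neighbourhood base. Near any
point `q`, every monomial equals a unique constant times a vertex at `q` (`exists_isCoef_expo`,
`IsCoef.unique`); this constant is an additive valuation `val q`. A vertex has value 1 at its own
point, value 2 at the points of its children, and value 0 at all other points of the same or larger
height.

Conversely, a function of this local form whose support is covered by finitely many vertices is a
monomial (`mem_of_isLocal`), by a compactness argument run by induction on heights and components.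
Hence monomials are closed under minimum and truncated difference: they have gcds, and divisibility
is the pointwise order.

Gauss's lemma (`closure_S`) shows that `S` is multiplicatively closed. In `D` every nonzero element
is a unit times a monomial, and monomials without common factor are comaximal, because their sum
lies in `S` (or both are 1). These properties are axiomatized in `IsMonRing β`, where only points of
height at least `β` count: `D` satisfies them for `β = 0`, and the overring `T_β` of `D` inherits
them for `β` (`overring_isMonRing`). Such a ring is Bézout, each counted point gives a maximal
ideal, and in `D` there are no others (`exists_eq_ptIdeal`).

In `T_β` a point of height exactly `β` is not critical, since its vertices have values 0 and 1 only
and generate radical ideals. A higher point is critical: a monomial in its ideal is divisible by one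
of its vertices, which has value 2 at some point of height at least `β`, so the monomial does not
generate a radical ideal (`isCritical_ptIdeal_iff`). Transfinite induction (`critSet_eq`) then gives
the critical sets and the SP-rank. -/

theorem tau_apply (β : Ordinal.{u}) (t : Ordinal.{u} →₀ Ordinal.{u}) (γ : Ordinal.{u}) :
    tau β t γ = if β < γ then t γ else 0 := by
  classical
  simp only [tau, Finsupp.filter_apply]

theorem tau_apply_of_lt {β γ : Ordinal.{u}} (t : Ordinal.{u} →₀ Ordinal.{u}) (h : β < γ) :
    tau β t γ = t γ := by rw [tau_apply, if_pos h]

theorem tau_apply_of_le {β γ : Ordinal.{u}} (t : Ordinal.{u} →₀ Ordinal.{u}) (h : γ ≤ β) :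
    tau β t γ = 0 := by rw [tau_apply, if_neg h.not_gt]

theorem IsSuccOrd.pos {β : Ordinal.{u}} (h : IsSuccOrd β) : 0 < β := by
  obtain ⟨γ, rfl⟩ := h
  exact (zero_le (a := γ)).trans_lt (lt_add_one γ)

theorem not_isSuccLimit_add_one (β : Ordinal.{u}) : ¬ Order.IsSuccLimit (β + 1) := fun h =>
  h.2 β (Order.covBy_add_one β)

theorem IsSuccOrd.not_isSuccLimit {β : Ordinal.{u}} (h : IsSuccOrd β) :
    ¬ Order.IsSuccLimit β := by
  obtain ⟨γ, rfl⟩ := h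
  exact not_isSuccLimit_add_one γ

theorem zero_or_isSuccOrd_or_isSuccLimit (β : Ordinal.{u}) :
    β = 0 ∨ IsSuccOrd β ∨ Order.IsSuccLimit β := by
  rcases Ordinal.zero_or_succ_or_isSuccLimit β with h | ⟨γ, h⟩ | h
  · exact Or.inl h
  · exact Or.inr (Or.inl ⟨γ, h.symm⟩)
  · exact Or.inr (Or.inr h)

/-- The component of the sequence at the height. -/
abbrev Vertex.param (v : Vertex α) : Ordinal.{u} := v.seq v.height

theorem Vertex.seq_of_lt (v : Vertex α) {δ : Ordinal.{u}} (h : δ < v.height) : v.seq δ = 0 :=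
  v.seq_mem.2.2.2.1 δ h

/-- The ordinals that are allowed as components at the height `β` of a vertex of that height. -/
def IsParam (β a : Ordinal.{u}) : Prop :=
  (β = 0 → a = 0) ∧ (IsSuccOrd β → a < ω) ∧ (Order.IsSuccLimit β → a < β)

theorem Vertex.isParam (v : Vertex α) : IsParam v.height v.param := by
  refine ⟨fun h => ?_, v.seq_mem.2.2.1 _, v.seq_mem.2.2.2.2⟩
  by_contra h0
  exact (v.seq_mem.1 _ h0).1.ne' h

theorem IsParam.mono {β a b : Ordinal.{u}} (h : IsParam β b) (hab : a ≤ b) : IsParam β a :=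
  ⟨fun h0 => le_antisymm (hab.trans (h.1 h0).le) (zero_le (a := a)),
    fun h1 => hab.trans_lt (h.2.1 h1), fun h2 => hab.trans_lt (h.2.2 h2)⟩

theorem IsParam.zero (β : Ordinal.{u}) : IsParam β 0 :=
  ⟨fun _ => rfl, fun _ => omega0_pos, fun h => h.bot_lt⟩

theorem IsParam.lt {β a : Ordinal.{u}} (h : IsParam β a) (hβ : β < α) : a < max ω α := by
  rcases zero_or_isSuccOrd_or_isSuccLimit β with h0 | h1 | h2
  · rw [h.1 h0]; exact lt_max_of_lt_left omega0_pos
  · exact lt_max_of_lt_left (h.2.1 h1)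
  · exact lt_max_of_lt_right ((h.2.2 h2).trans hβ)

theorem IsParam.succ {β a : Ordinal.{u}} (h : IsParam β a) (hβ : β ≠ 0) : IsParam β (a + 1) :=
  ⟨fun h0 => absurd h0 hβ, fun h1 => isSuccLimit_omega0.add_one_lt (h.2.1 h1),
    fun h2 => h2.add_one_lt (h.2.2 h2)⟩

/-- The vertex of height `β` with the component `a` at `β` and the components of `t` above. -/
def mkVertex (β : Ordinal.{u}) (hβ : β < α) (a : Ordinal.{u}) (ha : IsParam β a)
    (t : Ordinal.{u} →₀ Ordinal.{u}) (ht : t ∈ U α 0) : Vertex α where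
  height := β
  seq := tau β t + Finsupp.single β a
  height_lt := hβ
  seq_mem := by
    classical
    have key : ∀ γ, (tau β t + Finsupp.single β a) γ =
        if β < γ then t γ else if γ = β then a else 0 := by
      intro γ
      rw [Finsupp.add_apply, tau_apply, Finsupp.single_apply]
      rcases lt_trichotomy β γ with h | h | h
      · rw [if_pos h, if_pos h, if_neg h.ne, add_zero]
      · rw [if_neg h.not_lt, if_neg h.not_lt, if_pos h, if_pos h.symm, zero_add]
      · rw [if_neg h.not_gt, if_neg h.not_gt, if_neg h.ne', if_neg h.ne, zero_add]
    refine ⟨fun γ h => ?_, fun γ => ?_, fun γ hγ => ?_, fun δ hδ => ?_, fun hl => ?_⟩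
    · rw [key] at h
      split_ifs at h with h1 h2
      · exact ht.1 γ h
      · subst h2
        exact ⟨(Ne.bot_lt fun h0 => h (ha.1 h0)), hβ⟩
      · exact absurd rfl h
    · rw [key]
      split_ifs with h1 h2
      · exact ht.2.1 γ
      · exact ha.lt hβ
      · exact lt_max_of_lt_left omega0_pos
    · rw [key]
      split_ifs with h1 h2
      · exact ht.2.2.1 γ hγ
      · exact ha.2.1 (h2 ▸ hγ)
      · exact omega0_pos
    · rw [key, if_neg hδ.not_gt, if_neg hδ.ne]
    · rw [key, if_neg (lt_irrefl _), if_pos rfl]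
      exact ha.2.2 hl

section mkVertex

variable {β : Ordinal.{u}} {hβ : β < α} {a : Ordinal.{u}} {ha : IsParam β a}
  {t : Ordinal.{u} →₀ Ordinal.{u}} {ht : t ∈ U α 0}

theorem mkVertex_seq : (mkVertex β hβ a ha t ht).seq = tau β t + Finsupp.single β a := rfl

theorem mkVertex_seq_self : (mkVertex β hβ a ha t ht).seq β = a := by
  rw [mkVertex_seq, Finsupp.add_apply, tau_apply_of_le _ le_rfl, Finsupp.single_eq_same, zero_add]

theorem mkVertex_seq_of_lt {δ : Ordinal.{u}} (h : β < δ) :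
    (mkVertex β hβ a ha t ht).seq δ = t δ := by
  rw [mkVertex_seq, Finsupp.add_apply, tau_apply_of_lt _ h, Finsupp.single_eq_of_ne h.ne', add_zero]

end mkVertex

theorem zero_mem_U (β : Ordinal.{u}) : (0 : Ordinal.{u} →₀ Ordinal.{u}) ∈ U α β :=
  ⟨fun _ h => absurd rfl h, fun _ => lt_max_of_lt_left omega0_pos, fun _ _ => omega0_pos,
    fun _ _ => rfl, fun h => h.bot_lt⟩

theorem Vertex.seq_mem_zero (v : Vertex α) : v.seq ∈ U α 0 :=
  ⟨v.seq_mem.1, v.seq_mem.2.1, v.seq_mem.2.2.1, fun _ hδ => absurd hδ not_lt_bot,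
    fun h => absurd h Ordinal.not_isSuccLimit_zero⟩

theorem Vertex.ext_of {v w : Vertex α} (h : v.height = w.height)
    (hs : ∀ δ, v.height ≤ δ → v.seq δ = w.seq δ) : v = w := by
  refine Vertex.ext h (Finsupp.ext fun δ => ?_)
  rcases lt_or_ge δ v.height with h' | h'
  · rw [v.seq_of_lt h', w.seq_of_lt (h ▸ h')]
  · exact hs δ h'

/-- Two vertices that give rise to the same maximal ideal. -/
def SamePt (v w : Vertex α) : Prop :=
  v.height = w.height ∧ ∀ δ, v.height < δ → v.seq δ = w.seq δ

theorem SamePt.refl (v : Vertex α) : SamePt v v := ⟨rfl, fun _ _ => rfl⟩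

theorem SamePt.symm {v w : Vertex α} (h : SamePt v w) : SamePt w v :=
  ⟨h.1.symm, fun δ hδ => (h.2 δ (h.1 ▸ hδ)).symm⟩

theorem SamePt.trans {v w x : Vertex α} (h : SamePt v w) (h' : SamePt w x) : SamePt v x :=
  ⟨h.1.trans h'.1, fun δ hδ => (h.2 δ hδ).trans (h'.2 δ (h.1 ▸ hδ))⟩

theorem SamePt.eq {v w : Vertex α} (h : SamePt v w) (hp : v.param = w.param) : v = w := by
  refine Vertex.ext_of h.1 fun δ hδ => ?_
  rcases hδ.eq_or_lt with rfl | hδ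
  · exact hp.trans (by rw [Vertex.param, h.1])
  · exact h.2 δ hδ

/-- The vertex with the component at the height replaced by `a`. -/
def Vertex.withParam (v : Vertex α) (a : Ordinal.{u}) (ha : IsParam v.height a) : Vertex α :=
  mkVertex v.height v.height_lt a ha v.seq v.seq_mem_zero

theorem Vertex.withParam_samePt (v : Vertex α) (a : Ordinal.{u}) (ha : IsParam v.height a) :
    SamePt (v.withParam a ha) v :=
  ⟨rfl, fun _ hδ => mkVertex_seq_of_lt hδ⟩

theorem Vertex.withParam_param (v : Vertex α) (a : Ordinal.{u})
    (ha : IsParam v.height a) : (v.withParam a ha).param = a := mkVertex_seq_self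

/- Edges -/

theorem Edge.seq_of_lt {v c : Vertex α} (h : Edge v c) {δ : Ordinal.{u}} (hδ : v.height < δ) :
    c.seq δ = v.seq δ := by
  rcases h with ⟨-, k, -, h⟩ | ⟨-, -, -, -, h⟩
  · rw [h, Finsupp.add_apply, Finsupp.single_eq_of_ne hδ.ne', add_zero]
  · rw [h, tau_apply_of_lt _ hδ]

theorem Edge.param_eq_zero {v c : Vertex α} (h : Edge v c) : c.param = 0 := by
  have hlt := h.height_lt
  rcases h with ⟨-, k, -, h⟩ | ⟨-, -, -, -, h⟩
  · rw [Vertex.param, h, Finsupp.add_apply, Finsupp.single_eq_of_ne hlt.ne, add_zero,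
      v.seq_of_lt hlt]
  · rw [Vertex.param, h, tau_apply_of_le _ hlt.le]

theorem edge_succ_iff {v c : Vertex α} (hv : IsSuccOrd v.height) :
    Edge v c ↔ v.height = c.height + 1 ∧ c.param = 0 ∧ v.param < c.seq v.height ∧
      ∀ δ, v.height < δ → c.seq δ = v.seq δ := by
  constructor
  · intro h
    refine ⟨?_, h.param_eq_zero, ?_, fun δ => h.seq_of_lt⟩
    · rcases h with h | h
      · exact h.1
      · exact absurd h.1 hv.not_isSuccLimit
    · rcases h with ⟨-, k, hk, h⟩ | h
      · rw [h, Finsupp.add_apply, Finsupp.single_eq_same]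
        exact lt_add_of_pos_right _ (by exact_mod_cast hk)
      · exact absurd h.1 hv.not_isSuccLimit
  · rintro ⟨h1, h0, h2, h3⟩
    refine Or.inl ⟨h1, ?_⟩
    obtain ⟨m, hm⟩ := lt_omega0.1 (v.isParam.2.1 hv)
    obtain ⟨n, hn⟩ := lt_omega0.1 (c.seq_mem.2.2.1 _ hv)
    rw [hm, hn] at h2
    have h2' : m < n := by exact_mod_cast h2
    -- Components at successor indices are finite, so the integer `k` of the edge is recovered as a
    -- difference of natural numbers.
    refine ⟨n - m, by omega, Finsupp.ext fun δ => ?_⟩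
    rw [Finsupp.add_apply]
    rcases lt_trichotomy δ v.height with h | rfl | h
    · rw [Finsupp.single_eq_of_ne h.ne, add_zero, v.seq_of_lt h]
      rcases (Order.lt_add_one_iff.1 (h1 ▸ h)).eq_or_lt with rfl | h'
      · exact h0
      · exact c.seq_of_lt h'
    · rw [Finsupp.single_eq_same, hn]
      have : v.seq v.height = m := hm
      rw [this]
      exact_mod_cast (by omega : n = m + (n - m))
    · rw [Finsupp.single_eq_of_ne h.ne', add_zero, h3 δ h]

theorem edge_limit_iff {v c : Vertex α} (hv : Order.IsSuccLimit v.height) :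
    Edge v c ↔ IsSuccOrd c.height ∧ v.param < c.height ∧ c.height < v.height ∧ c.param = 0 ∧
      (∀ δ, c.height < δ → δ ≤ v.height → c.seq δ = 0) ∧
      ∀ δ, v.height < δ → c.seq δ = v.seq δ := by
  constructor
  · intro h
    rcases h with ⟨h, -⟩ | h
    · exact absurd hv (h ▸ not_isSuccLimit_add_one _)
    · have h' : Edge v c := Or.inr h
      refine ⟨h.2.1, h.2.2.1, h.2.2.2.1, h'.param_eq_zero, fun δ _ h2 => ?_, fun δ => h'.seq_of_lt⟩
      rw [h.2.2.2.2, tau_apply_of_le _ h2]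
  · rintro ⟨h1, h2, h3, h4, h5, h6⟩
    refine Or.inr ⟨hv, h1, h2, h3, Finsupp.ext fun δ => ?_⟩
    rcases le_or_gt δ v.height with h | h
    · rw [tau_apply_of_le _ h]
      rcases lt_trichotomy δ c.height with h' | rfl | h'
      · exact c.seq_of_lt h'
      · exact h4
      · exact h5 δ h' h
    · rw [tau_apply_of_lt _ h, h6 δ h]

theorem Edge.height_ne_zero {v c : Vertex α} (h : Edge v c) : v.height ≠ 0 :=
  h.height_lt.ne_bot

/-- The target of an edge has component zero at its own height, so it is determined by its point. -/
theorem Edge.of_samePt {v c c' : Vertex α} (h : Edge v c) (h' : Edge v c')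
    (hc : SamePt c c') : c = c' :=
  hc.eq (h.param_eq_zero.trans h'.param_eq_zero.symm)

/- Supports -/

theorem expo_of_height_eq_zero {v : Vertex α} (hv : v.height = 0) (r : U α 0) :
    expo v r ≠ 0 ↔ v.seq = r := by
  classical
  rw [expo, if_pos hv]
  split_ifs with h <;> simp [h]

theorem expo_eq_one {v : Vertex α} (hv : v.height = 0) {r : U α 0} (h : expo v r ≠ 0) :
    expo v r = 1 := by
  classical
  rw [expo_of_height_eq_zero hv] at h
  rw [expo, if_pos hv, if_pos h]

theorem exists_edge_of_expo_ne_zero {v : Vertex α} (hv : v.height ≠ 0) {r : U α 0}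
    (h : expo v r ≠ 0) : ∃ c, Edge v c ∧ expo c r ≠ 0 := by
  classical
  rw [expo, if_neg hv] at h
  by_contra! h'
  exact h (finsum_eq_zero_of_forall_eq_zero fun c => by rw [h' c.1 c.2, mul_zero])

/-- No edge on the way down from `v` to `r` changes a component above the height of `v`. -/
theorem seq_eq_of_expo_ne_zero (v : Vertex α) {r : U α 0} (h : expo v r ≠ 0) {δ : Ordinal.{u}}
    (hδ : v.height < δ) : r.1 δ = v.seq δ := by
  by_cases hv : v.height = 0
  · rw [(expo_of_height_eq_zero hv r).1 h]
  · obtain ⟨c, hc, h'⟩ := exists_edge_of_expo_ne_zero hv h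
    rw [seq_eq_of_expo_ne_zero c h' (hc.height_lt.trans hδ), hc.seq_of_lt hδ]
termination_by v.height
decreasing_by exact hc.height_lt

theorem Edge.height_eq {v c : Vertex α} (hv : IsSuccOrd v.height) (h : Edge v c) :
    v.height = c.height + 1 := ((edge_succ_iff hv).1 h).1

/-- The component at a successor height of an element of the support. -/
theorem param_lt_of_expo_ne_zero {v : Vertex α} (hv : IsSuccOrd v.height) {r : U α 0}
    (h : expo v r ≠ 0) : v.param < r.1 v.height := by
  obtain ⟨c, hc, h'⟩ := exists_edge_of_expo_ne_zero hv.pos.ne' h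
  rw [seq_eq_of_expo_ne_zero c h' hc.height_lt]
  exact ((edge_succ_iff hv).1 hc).2.2.1

/-- The height of the child can be read off from `r`: it is the last index up to the height of `v`
with a nonzero component. The component there is nonzero because the child has successor height, and
`tau` has erased those in between. -/
theorem Edge.top_of_expo_ne_zero {v c : Vertex α} (hv : Order.IsSuccLimit v.height)
    (hc : Edge v c) {r : U α 0} (h : expo c r ≠ 0) :
    r.1 c.height ≠ 0 ∧ ∀ δ, c.height < δ → δ ≤ v.height → r.1 δ = 0 := by
  have hc' := (edge_limit_iff hv).1 hc
  refine ⟨((zero_le (a := c.param)).trans_lt (param_lt_of_expo_ne_zero hc'.1 h)).ne',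
    fun δ h1 h2 => ?_⟩
  rw [seq_eq_of_expo_ne_zero c h h1, hc'.2.2.2.2.1 δ h1 h2]

/-- The part of an element of `U_0` that determines the edge from `v` leading to it. -/
theorem Edge.eq_of_expo_ne_zero {v c c' : Vertex α} (hc : Edge v c) (hc' : Edge v c')
    {r r' : U α 0} (h : expo c r ≠ 0) (h' : expo c' r' ≠ 0)
    (hr : ∀ δ, c.height ≤ δ → δ ≤ v.height → (IsSuccOrd v.height → δ = v.height) →
      r.1 δ = r'.1 δ) : c = c' := by
  refine hc.of_samePt hc' ?_
  rcases zero_or_isSuccOrd_or_isSuccLimit v.height with hv | hv | hv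
  · exact absurd hv hc.height_ne_zero
  · have h1 : c.height = c'.height :=
      Order.add_one_inj.1 ((hc.height_eq hv).symm.trans (hc'.height_eq hv))
    refine ⟨h1, fun δ hδ => ?_⟩
    rcases ((hc.height_eq hv).trans_le (Order.add_one_le_iff.2 hδ)).eq_or_lt with rfl | h2
    · rw [← seq_eq_of_expo_ne_zero c h hδ, ← seq_eq_of_expo_ne_zero c' h' (h1 ▸ hδ),
        hr _ hc.height_lt.le le_rfl fun _ => rfl]
    · rw [hc.seq_of_lt h2, hc'.seq_of_lt h2]
  · have hc0 := (edge_limit_iff hv).1 hc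
    have hc1 := (edge_limit_iff hv).1 hc'
    have a0 := hc.top_of_expo_ne_zero hv h
    have a1 := hc'.top_of_expo_ne_zero hv h'
    have no : IsSuccOrd v.height → ∀ {δ}, δ = v.height := fun h => absurd hv h.not_isSuccLimit
    have h1 : c.height = c'.height := by
      rcases lt_trichotomy c.height c'.height with h1 | h1 | h1
      · refine absurd (a0.2 _ h1 hc'.height_lt.le) ?_
        rw [hr _ h1.le hc'.height_lt.le fun h => no h]
        exact a1.1
      · exact h1
      · refine absurd (a1.2 _ h1 hc.height_lt.le) ?_
        rw [← hr _ le_rfl hc.height_lt.le fun h => no h]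
        exact a0.1
    refine ⟨h1, fun δ hδ => ?_⟩
    rcases le_or_gt δ v.height with h2 | h2
    · rw [hc0.2.2.2.2.1 δ hδ h2, hc1.2.2.2.2.1 δ (h1 ▸ hδ) h2]
    · rw [hc.seq_of_lt h2, hc'.seq_of_lt h2]

/-- Distinct children have disjoint supports, so the sum defining the exponent reduces to one term.
-/
theorem Edge.expo_eq {v c : Vertex α} (hc : Edge v c) {r : U α 0} (h : expo c r ≠ 0) :
    expo v r = 2 * expo c r := by
  classical
  rw [expo, if_neg hc.height_ne_zero, finsum_eq_single _ (⟨c, hc⟩ : {w : Vertex α // Edge v w})]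
  rintro ⟨c', hc'⟩ hne
  by_contra h'
  exact hne (Subtype.ext (hc'.eq_of_expo_ne_zero hc (right_ne_zero_of_mul h') h
    fun _ _ _ _ => rfl))

theorem Edge.expo_ne_zero {v c : Vertex α} (hc : Edge v c) {r : U α 0} (h : expo c r ≠ 0) :
    expo v r ≠ 0 := by
  rw [hc.expo_eq h]; exact mul_ne_zero two_ne_zero h

theorem edge_mkVertex_succ {v : Vertex α} {γ : Ordinal.{u}} (hv : v.height = γ + 1) :
    ∃ c, Edge v c ∧ c.height = γ ∧ c.seq v.height = v.param + 1 := by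
  have hs : IsSuccOrd v.height := ⟨γ, hv⟩
  have hγ : γ < v.height := hv ▸ lt_add_one γ
  let v' := v.withParam (v.param + 1) (v.isParam.succ hs.pos.ne')
  let c := mkVertex γ (hγ.trans v.height_lt) 0 (IsParam.zero γ) v'.seq v'.seq_mem_zero
  have h1 : c.seq v.height = v.param + 1 := (mkVertex_seq_of_lt hγ).trans (v.withParam_param _ _)
  refine ⟨c, (edge_succ_iff hs).2 ⟨hv, mkVertex_seq_self, ?_, fun δ hδ => ?_⟩, rfl, h1⟩
  · rw [h1]; exact lt_add_one _
  · exact (mkVertex_seq_of_lt (hγ.trans hδ)).trans ((v.withParam_samePt _ _).2 δ hδ)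

theorem edge_mkVertex_limit {v : Vertex α} (hv : Order.IsSuccLimit v.height) {γ : Ordinal.{u}}
    (hγ : IsSuccOrd γ) (h1 : v.param < γ) (h2 : γ < v.height) :
    ∃ c, Edge v c ∧ c.height = γ := by
  let v' := v.withParam 0 (IsParam.zero _)
  let c := mkVertex γ (h2.trans v.height_lt) 0 (IsParam.zero γ) v'.seq v'.seq_mem_zero
  refine ⟨c, (edge_limit_iff hv).2 ⟨hγ, h1, h2, mkVertex_seq_self, fun δ h3 h4 => ?_,
    fun δ hδ => ?_⟩, rfl⟩
  · refine (mkVertex_seq_of_lt h3).trans ?_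
    rcases h4.eq_or_lt with rfl | h4
    · exact v.withParam_param _ _
    · exact v'.seq_of_lt h4
  · exact (mkVertex_seq_of_lt (h2.trans hδ)).trans ((v.withParam_samePt _ _).2 δ hδ)

theorem exists_edge {v : Vertex α} (hv : v.height ≠ 0) : ∃ c, Edge v c := by
  rcases zero_or_isSuccOrd_or_isSuccLimit v.height with h | ⟨γ, h⟩ | h
  · exact absurd h hv
  · obtain ⟨c, hc, -⟩ := edge_mkVertex_succ h
    exact ⟨c, hc⟩
  · obtain ⟨c, hc, -⟩ := edge_mkVertex_limit h ⟨v.param, rfl⟩ (lt_add_one _)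
      (h.add_one_lt (v.isParam.2.2 h))
    exact ⟨c, hc⟩

theorem exists_expo_ne_zero (v : Vertex α) : ∃ r, expo v r ≠ 0 := by
  by_cases hv : v.height = 0
  · exact ⟨⟨v.seq, v.seq_mem_zero⟩, (expo_of_height_eq_zero hv _).2 rfl⟩
  · obtain ⟨c, hc⟩ := exists_edge hv
    obtain ⟨r, hr⟩ := exists_expo_ne_zero c
    exact ⟨r, hc.expo_ne_zero hr⟩
termination_by v.height
decreasing_by exact hc.height_lt

/-- A larger component at the height leaves fewer children, and the remaining ones are shared. So
`w'` is the restriction of `w` to a smaller support. -/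
theorem SamePt.expo_eq {w w' : Vertex α} (h : SamePt w w') (hp : w.param ≤ w'.param)
    {r : U α 0} (hr : expo w' r ≠ 0) : expo w r = expo w' r := by
  rcases zero_or_isSuccOrd_or_isSuccLimit w.height with h0 | h0 | h0
  · rw [h.eq]
    rw [w.isParam.1 h0, w'.isParam.1 (h.1 ▸ h0)]
  · obtain ⟨c, hc, hcr⟩ := exists_edge_of_expo_ne_zero (h.1 ▸ h0.pos.ne') hr
    rw [hc.expo_eq hcr]
    refine Edge.expo_eq ?_ hcr
    rw [edge_succ_iff (h.1 ▸ h0)] at hc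
    rw [edge_succ_iff h0, h.1]
    exact ⟨hc.1, hc.2.1, hp.trans_lt hc.2.2.1,
      fun δ hδ => (hc.2.2.2 δ hδ).trans (h.symm.2 δ hδ)⟩
  · obtain ⟨c, hc, hcr⟩ := exists_edge_of_expo_ne_zero (h.1 ▸ h0.bot_lt.ne') hr
    rw [hc.expo_eq hcr]
    refine Edge.expo_eq ?_ hcr
    rw [edge_limit_iff (h.1 ▸ h0)] at hc
    rw [edge_limit_iff h0, h.1]
    exact ⟨hc.1, hp.trans_lt hc.2.1, hc.2.2.1, hc.2.2.2.1, hc.2.2.2.2.1,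
      fun δ hδ => (hc.2.2.2.2.2 δ hδ).trans (h.symm.2 δ hδ)⟩

end Graph

/- ### Local behaviour of the vertices -/

section Local

variable {α : Ordinal.{u}}

/-- Near a point of smaller height in the support of `v`, the vertex `v` behaves like a multiple
of one of its neighbours, or like a vertex of smaller height. -/
theorem exists_edge_or_samePt {v q : Vertex α} (hq : q.height < v.height) {r₀ : U α 0}
    (hr : expo q r₀ ≠ 0) (hrv : expo v r₀ ≠ 0) :
    (∃ c, Edge v c ∧ ∀ w, SamePt w q → ∀ r, expo w r ≠ 0 → expo v r ≠ 0 → expo c r ≠ 0) ∨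
      ∃ w, SamePt w q ∧ ∀ r, expo w r ≠ 0 → expo v r = expo w r := by
  have hv0 : v.height ≠ 0 := hq.ne_bot
  obtain ⟨c, hc, hcr⟩ := exists_edge_of_expo_ne_zero hv0 hrv
  have above : ∀ w, SamePt w q → ∀ r, expo w r ≠ 0 → ∀ δ, q.height < δ → r.1 δ = r₀.1 δ := by
    intro w hw r hr' δ hδ
    rw [seq_eq_of_expo_ne_zero w hr' (hw.1 ▸ hδ), seq_eq_of_expo_ne_zero q hr hδ,
      hw.2 δ (hw.1 ▸ hδ)]
  rcases zero_or_isSuccOrd_or_isSuccLimit v.height with hv | hv | hv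
  · exact absurd hv hv0
  · left
    refine ⟨c, hc, fun w hw r h1 h2 => ?_⟩
    obtain ⟨c', hc', hcr'⟩ := exists_edge_of_expo_ne_zero hv0 h2
    rwa [hc.eq_of_expo_ne_zero hc' hcr hcr' fun δ _ _ h => ?_]
    rw [h hv]
    exact (above w hw r h1 _ hq).symm
  · have htop := hc.top_of_expo_ne_zero hv hcr
    have hc0 := (edge_limit_iff hv).1 hc
    have child : ∀ w, SamePt w q → ∀ r, expo w r ≠ 0 → expo v r ≠ 0 → q.height ≤ c.height →
        r.1 c.height ≠ 0 → expo c r ≠ 0 := by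
      intro w hw r h1 h2 hle h3
      obtain ⟨c', hc', hcr'⟩ := exists_edge_of_expo_ne_zero hv0 h2
      have htop' := hc'.top_of_expo_ne_zero hv hcr'
      have hle' : c.height ≤ c'.height := by
        by_contra! hlt
        exact h3 (htop'.2 _ hlt hc.height_lt.le)
      rcases hle'.eq_or_lt with he | hlt
      · rwa [hc.of_samePt hc' ⟨he, fun δ hδ => ?_⟩]
        rcases le_or_gt δ v.height with h | h
        · rw [hc0.2.2.2.2.1 δ hδ h, ((edge_limit_iff hv).1 hc').2.2.2.2.1 δ (he ▸ hδ) h]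
        · rw [hc.seq_of_lt h, hc'.seq_of_lt h]
      · refine absurd ?_ htop'.1
        rw [above w hw r h1 _ (hle.trans_lt hlt)]
        exact htop.2 _ hlt hc'.height_lt.le
    rcases lt_trichotomy q.height c.height with hlt | heq | hgt
    · left
      refine ⟨c, hc, fun w hw r h1 h2 => child w hw r h1 h2 hlt.le ?_⟩
      rw [above w hw r h1 _ hlt]
      exact htop.1
    · left
      refine ⟨c, hc, fun w hw r h1 h2 => child w hw r h1 h2 heq.le ?_⟩
      have hs : IsSuccOrd w.height := by rw [hw.1, heq]; exact hc0.1
      have := param_lt_of_expo_ne_zero hs h1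
      rw [hw.1, heq] at this
      exact this.ne_bot
    · have h0 : r₀.1 q.height = 0 := htop.2 _ hgt hq.le
      rcases zero_or_isSuccOrd_or_isSuccLimit q.height with hq' | hq' | hq'
      · exact absurd hgt (hq' ▸ not_lt_bot)
      · exact absurd h0 (param_lt_of_expo_ne_zero hq' hr).ne_bot
      · right
        have hp : v.param < q.height := hc0.2.1.trans hgt
        -- Here the child of `v` lies below the limit height of `q`. The children of a vertex at `q`
        -- with the component of `v` are then also children of `v`.
        let w := q.withParam v.param ⟨fun h => absurd h hq'.bot_lt.ne',
          fun h => absurd hq' h.not_isSuccLimit, fun _ => hp⟩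
        have hw : SamePt w q := q.withParam_samePt _ _
        have hwp : w.param = v.param := q.withParam_param _ _
        refine ⟨w, hw, fun r h1 => ?_⟩
        obtain ⟨c', hc', hcr'⟩ := exists_edge_of_expo_ne_zero (v := w) hq'.bot_lt.ne' h1
        rw [hc'.expo_eq hcr']
        refine Edge.expo_eq ((edge_limit_iff hv).2 ?_) hcr'
        have hc1 := (edge_limit_iff (v := w) hq').1 hc'
        have hlt : c'.height < q.height := hc1.2.2.1
        refine ⟨hc1.1, hwp ▸ hc1.2.1, hlt.trans hq, hc1.2.2.2.1, fun δ h2 h3 => ?_, fun δ hδ => ?_⟩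
        · rcases le_or_gt δ q.height with h | h
          · exact hc1.2.2.2.2.1 δ h2 h
          · rw [hc1.2.2.2.2.2 δ h, hw.2 δ h, ← seq_eq_of_expo_ne_zero q hr h]
            exact htop.2 δ (hgt.trans h) h3
        · rw [hc1.2.2.2.2.2 δ (hq.trans hδ), hw.2 δ (hq.trans hδ),
            ← seq_eq_of_expo_ne_zero q hr (hq.trans hδ), seq_eq_of_expo_ne_zero v hrv hδ]

/-- A vertex is away from all points of larger height. -/
theorem exists_disjoint_of_height_lt {v q : Vertex α} (hq : v.height < q.height) :
    ∃ w, SamePt w q ∧ ∀ r, expo w r ≠ 0 → expo v r = 0 := by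
  rcases zero_or_isSuccOrd_or_isSuccLimit q.height with h | h | h
  · exact absurd hq (h ▸ not_lt_bot)
  · let w := q.withParam (v.seq q.height) ⟨fun h0 => absurd h0 h.pos.ne',
      fun _ => v.seq_mem.2.2.1 _ h, fun h' => absurd h' h.not_isSuccLimit⟩
    have hw : w.param = v.seq q.height := q.withParam_param _ _
    refine ⟨w, q.withParam_samePt _ _, fun r hr => ?_⟩
    by_contra hr'
    have : w.param < r.1 q.height := param_lt_of_expo_ne_zero (v := w) h hr
    rw [hw, seq_eq_of_expo_ne_zero v hr' hq] at this
    exact lt_irrefl _ this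
  · let ρ := (insert v.height (v.seq.support.filter (· < q.height))).sup id
    have hρ : ρ < q.height := by
      rw [Finset.sup_lt_iff h.bot_lt]
      intro b hb
      rcases Finset.mem_insert.1 hb with rfl | hb
      · exact hq
      · exact (Finset.mem_filter.1 hb).2
    have hle : ∀ δ, v.seq δ ≠ 0 → δ < q.height → δ ≤ ρ := fun δ h1 h2 =>
      Finset.le_sup (f := id) (Finset.mem_insert_of_mem
        (Finset.mem_filter.2 ⟨Finsupp.mem_support_iff.2 h1, h2⟩))
    have hvρ : v.height ≤ ρ := Finset.le_sup (f := id) (Finset.mem_insert_self _ _)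
    let w := q.withParam ρ ⟨fun h0 => absurd h0 h.bot_lt.ne',
      fun h' => absurd h h'.not_isSuccLimit, fun _ => hρ⟩
    have hwρ : w.param = ρ := q.withParam_param _ _
    refine ⟨w, q.withParam_samePt _ _, fun r hr => ?_⟩
    by_contra hr'
    obtain ⟨c, hc, hcr⟩ := exists_edge_of_expo_ne_zero (v := w) h.bot_lt.ne' hr
    have htop := hc.top_of_expo_ne_zero (v := w) h hcr
    have hρc : ρ < c.height := hwρ ▸ ((edge_limit_iff (v := w) h).1 hc).2.1
    rw [seq_eq_of_expo_ne_zero v hr' (hvρ.trans_lt hρc)] at htop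
    exact hρc.not_ge (hle _ htop.1 hc.height_lt)

/-- The function `f` equals `c` times `w` on the support of a vertex `w` at the point of `q`. -/
def IsCoef (q : Vertex α) (f : U α 0 → ℕ) (c : ℕ) : Prop :=
  ∃ w, SamePt w q ∧ ∀ r, expo w r ≠ 0 → f r = c * expo w r

/-- Induction on the height of `v`: near a lower point, `v` is disjoint from it, is the square of a
child, or coincides with a vertex at that point. The second conjunct says where a nonzero value can
occur. -/
theorem exists_isCoef_expo (v q : Vertex α) :
    ∃ c, IsCoef q (expo v) c ∧ (c = 0 ∨ q.height < v.height ∨ SamePt q v) := by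
  rcases lt_trichotomy v.height q.height with h | h | h
  · obtain ⟨w, hw, h'⟩ := exists_disjoint_of_height_lt h
    exact ⟨0, ⟨w, hw, fun r hr => by rw [h' r hr, zero_mul]⟩, Or.inl rfl⟩
  · by_cases hs : SamePt q v
    · exact ⟨1, ⟨v, hs.symm, fun r _ => (one_mul _).symm⟩, Or.inr (Or.inr hs)⟩
    · refine ⟨0, ⟨q, SamePt.refl q, fun r hr => ?_⟩, Or.inl rfl⟩
      rw [zero_mul]
      by_contra hr'
      refine hs ⟨h.symm, fun δ hδ => ?_⟩
      rw [← seq_eq_of_expo_ne_zero q hr hδ, seq_eq_of_expo_ne_zero v hr' (h ▸ hδ)]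
  · by_cases hd : ∀ r, expo q r ≠ 0 → expo v r = 0
    · exact ⟨0, ⟨q, SamePt.refl q, fun r hr => by rw [hd r hr, zero_mul]⟩, Or.inl rfl⟩
    · push Not at hd
      obtain ⟨r₀, h1, h2⟩ := hd
      rcases exists_edge_or_samePt h h1 h2 with ⟨c, hc, hcv⟩ | ⟨w, hw, hwv⟩
      · obtain ⟨k, ⟨w, hw, hk⟩, -⟩ := exists_isCoef_expo c q
        refine ⟨2 * k, ⟨w, hw, fun r hr => ?_⟩, Or.inr (Or.inl h)⟩
        rw [mul_assoc, ← hk r hr]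
        by_cases hcr : expo c r = 0
        · rw [hcr, mul_zero]
          by_contra hvr
          exact hcv w hw r hr hvr hcr
        · exact hc.expo_eq hcr
      · exact ⟨1, ⟨w, hw, fun r hr => by rw [hwv r hr, one_mul]⟩, Or.inr (Or.inl h)⟩
termination_by v.height
decreasing_by exact hc.height_lt

theorem SamePt.exists_le_le {w w' q : Vertex α} (hw : SamePt w q) (hw' : SamePt w' q) :
    ∃ x, SamePt x q ∧ w.param ≤ x.param ∧ w'.param ≤ x.param := by
  rcases le_total w.param w'.param with h | h
  · exact ⟨w', hw', h, le_rfl⟩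
  · exact ⟨w, hw, le_rfl, h⟩

theorem SamePt.expo_ne_zero {w x : Vertex α} (h : SamePt w x) (hp : w.param ≤ x.param)
    {r : U α 0} (hr : expo x r ≠ 0) : expo w r ≠ 0 := by rwa [h.expo_eq hp hr]

/-- Two witnesses can be compared on the smaller of their supports, which is nonempty. -/
theorem IsCoef.unique {q : Vertex α} {f : U α 0 → ℕ} {c d : ℕ} (hc : IsCoef q f c)
    (hd : IsCoef q f d) : c = d := by
  obtain ⟨w, hw, hc⟩ := hc
  obtain ⟨w', hw', hd⟩ := hd
  obtain ⟨x, hx, h1, h2⟩ := hw.exists_le_le hw'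
  obtain ⟨r, hr⟩ := exists_expo_ne_zero x
  have e1 := (hw.trans hx.symm).expo_eq h1 hr
  have e2 := (hw'.trans hx.symm).expo_eq h2 hr
  have h3 := (hc r (e1 ▸ hr)).symm.trans (hd r (e2 ▸ hr))
  rw [e1, e2] at h3
  exact Nat.eq_of_mul_eq_mul_right (Nat.pos_of_ne_zero hr) h3

theorem IsCoef.add {q : Vertex α} {f g : U α 0 → ℕ} {c d : ℕ} (hc : IsCoef q f c)
    (hd : IsCoef q g d) : IsCoef q (f + g) (c + d) := by
  obtain ⟨w, hw, hc⟩ := hc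
  obtain ⟨w', hw', hd⟩ := hd
  obtain ⟨x, hx, h1, h2⟩ := hw.exists_le_le hw'
  refine ⟨x, hx, fun r hr => ?_⟩
  have e1 := (hw.trans hx.symm).expo_eq h1 hr
  have e2 := (hw'.trans hx.symm).expo_eq h2 hr
  rw [Pi.add_apply, hc r (e1 ▸ hr), hd r (e2 ▸ hr), e1, e2, add_mul]

theorem IsCoef.inf {q : Vertex α} {f g : U α 0 → ℕ} {c d : ℕ} (hc : IsCoef q f c)
    (hd : IsCoef q g d) : IsCoef q (f ⊓ g) (c ⊓ d) := by
  obtain ⟨w, hw, hc⟩ := hc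
  obtain ⟨w', hw', hd⟩ := hd
  obtain ⟨x, hx, h1, h2⟩ := hw.exists_le_le hw'
  refine ⟨x, hx, fun r hr => ?_⟩
  have e1 := (hw.trans hx.symm).expo_eq h1 hr
  have e2 := (hw'.trans hx.symm).expo_eq h2 hr
  rw [Pi.inf_apply, hc r (e1 ▸ hr), hd r (e2 ▸ hr), e1, e2]
  exact Nat.mul_min_mul_right ..

theorem IsCoef.sub {q : Vertex α} {f g : U α 0 → ℕ} {c d : ℕ} (hc : IsCoef q f c)
    (hd : IsCoef q g d) : IsCoef q (f - g) (c - d) := by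
  obtain ⟨w, hw, hc⟩ := hc
  obtain ⟨w', hw', hd⟩ := hd
  obtain ⟨x, hx, h1, h2⟩ := hw.exists_le_le hw'
  refine ⟨x, hx, fun r hr => ?_⟩
  have e1 := (hw.trans hx.symm).expo_eq h1 hr
  have e2 := (hw'.trans hx.symm).expo_eq h2 hr
  rw [Pi.sub_apply, hc r (e1 ▸ hr), hd r (e2 ▸ hr), e1, e2, Nat.sub_mul]

theorem IsCoef.zero (q : Vertex α) : IsCoef q 0 0 :=
  ⟨q, SamePt.refl q, fun r _ => by rw [zero_mul]; rfl⟩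

/-- The functions that are multiples of a vertex near every point. -/
def IsLocal (f : U α 0 → ℕ) : Prop := ∀ q : Vertex α, ∃ c, IsCoef q f c

theorem isLocal_of_mem {f : U α 0 → ℕ} (hf : f ∈ Mon α) : IsLocal f := by
  intro q
  induction hf using AddSubmonoid.closure_induction with
  | mem f hf =>
    obtain ⟨v, rfl⟩ := hf
    obtain ⟨c, hc, -⟩ := exists_isCoef_expo v q
    exact ⟨c, hc⟩
  | zero => exact ⟨0, IsCoef.zero q⟩
  | add f g _ _ hf hg =>
    obtain ⟨c, hc⟩ := hf
    obtain ⟨d, hd⟩ := hg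
    exact ⟨c + d, hc.add hd⟩

theorem expo_mem (v : Vertex α) : expo v ∈ Mon α := AddSubmonoid.subset_closure ⟨v, rfl⟩

open Classical in
/-- The restriction of a function to the support of a vertex, extended by zero. -/
def restr (v : Vertex α) (f : U α 0 → ℕ) (r : U α 0) : ℕ := if expo v r = 0 then 0 else f r

theorem restr_of_ne {v : Vertex α} {f : U α 0 → ℕ} {r : U α 0} (h : expo v r ≠ 0) :
    restr v f r = f r := if_neg h

theorem restr_of_eq {v : Vertex α} {f : U α 0 → ℕ} {r : U α 0} (h : expo v r = 0) :
    restr v f r = 0 := if_pos h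

/-- If `v` has coefficient zero at `q`, the restriction vanishes near `q`; otherwise the support of
`v` contains a neighbourhood of `q` and nothing changes there. -/
theorem IsLocal.restr {f : U α 0 → ℕ} (hf : IsLocal f) (v : Vertex α) : IsLocal (restr v f) := by
  intro q
  obtain ⟨c, w, hw, hc⟩ := hf q
  obtain ⟨d, w', hw', hd⟩ := isLocal_of_mem (expo_mem v) q
  obtain ⟨x, hx, h1, h2⟩ := hw.exists_le_le hw'
  have e1 := fun {r} => (hw.trans hx.symm).expo_eq h1 (r := r)
  have e2 := fun {r} => (hw'.trans hx.symm).expo_eq h2 (r := r)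
  by_cases h0 : d = 0
  · refine ⟨0, x, hx, fun r hr => ?_⟩
    rw [zero_mul, restr_of_eq]
    rw [hd r (e2 hr ▸ hr), h0, zero_mul]
  · refine ⟨c, x, hx, fun r hr => ?_⟩
    rw [restr_of_ne, hc r (e1 hr ▸ hr), e1 hr]
    rw [hd r (e2 hr ▸ hr)]
    exact mul_ne_zero h0 (e2 hr ▸ hr)

theorem restr_eq_add {v x c : Vertex α} (f : U α 0 → ℕ)
    (h : ∀ r, expo v r ≠ 0 ↔ expo x r ≠ 0 ∨ expo c r ≠ 0)
    (h' : ∀ r, expo x r ≠ 0 → expo c r = 0) : restr v f = restr x f + restr c f := by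
  funext r
  rw [Pi.add_apply]
  by_cases h1 : expo x r = 0
  · rw [restr_of_eq h1, zero_add]
    by_cases h2 : expo c r = 0
    · rw [restr_of_eq h2, restr_of_eq]
      by_contra h3
      exact ((h r).1 h3).elim (· h1) (· h2)
    · rw [restr_of_ne h2, restr_of_ne ((h r).2 (Or.inr h2))]
  · rw [restr_of_ne h1, restr_of_eq (h' r h1), add_zero, restr_of_ne ((h r).2 (Or.inl h1))]

end Local

/- ### The monoid of monomials as a monoid of locally described functions -/

section Monoid

variable {α : Ordinal.{u}}

/-- The edges starting from two vertices at the same point with different parameters. -/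
theorem SamePt.edge_iff {v x c : Vertex α} (h : SamePt x v) (hv : v.height ≠ 0)
    (hp : v.param ≤ x.param) :
    Edge x c ↔ Edge v c ∧ (IsSuccOrd v.height → x.param < c.seq v.height) ∧
      (Order.IsSuccLimit v.height → x.param < c.height) := by
  rcases zero_or_isSuccOrd_or_isSuccLimit v.height with h0 | h0 | h0
  · exact absurd h0 hv
  · rw [edge_succ_iff h0, edge_succ_iff (h.1 ▸ h0), h.1]
    constructor
    · rintro ⟨h1, h2, h3, h4⟩
      exact ⟨⟨h1, h2, hp.trans_lt h3, fun δ hδ => (h4 δ hδ).trans (h.2 δ (h.1 ▸ hδ))⟩,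
        fun _ => h3, fun h' => absurd h' h0.not_isSuccLimit⟩
    · rintro ⟨⟨h1, h2, -, h4⟩, h3, -⟩
      exact ⟨h1, h2, h3 h0, fun δ hδ => (h4 δ hδ).trans (h.2 δ (h.1 ▸ hδ)).symm⟩
  · rw [edge_limit_iff h0, edge_limit_iff (h.1 ▸ h0), h.1]
    constructor
    · rintro ⟨h1, h2, h3, h4, h5, h6⟩
      exact ⟨⟨h1, hp.trans_lt h2, h3, h4, h5, fun δ hδ => (h6 δ hδ).trans (h.2 δ (h.1 ▸ hδ))⟩,
        fun h' => absurd h0 h'.not_isSuccLimit, fun _ => h2⟩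
    · rintro ⟨⟨h1, -, h3, h4, h5, h6⟩, -, h2⟩
      exact ⟨h1, h2 h0, h3, h4, h5, fun δ hδ => (h6 δ hδ).trans (h.2 δ (h.1 ▸ hδ)).symm⟩

/-- The child of `v` that is removed when the parameter is increased by one. -/
theorem exists_split_succ {v x : Vertex α} (h : SamePt x v) (hv : v.height ≠ 0)
    (hp : x.param = v.param + 1) : ∃ c : Vertex α, c.height < v.height ∧
      ∀ f : U α 0 → ℕ, restr v f = restr x f + restr c f := by
  have hle : v.param ≤ x.param := hp ▸ (lt_add_one _).le
  have key : ∃ c, Edge v c ∧ (IsSuccOrd v.height → c.seq v.height = v.param + 1) ∧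
      (Order.IsSuccLimit v.height → c.height = v.param + 1) := by
    rcases zero_or_isSuccOrd_or_isSuccLimit v.height with h0 | ⟨γ, h0⟩ | h0
    · exact absurd h0 hv
    · obtain ⟨c, hc, -, h1⟩ := edge_mkVertex_succ h0
      exact ⟨c, hc, fun _ => h1, fun h' => absurd h' (h0 ▸ not_isSuccLimit_add_one _)⟩
    · obtain ⟨c, hc, h1⟩ := edge_mkVertex_limit h0 ⟨v.param, rfl⟩ (lt_add_one _)
        (h0.add_one_lt (v.isParam.2.2 h0))
      exact ⟨c, hc, fun h' => absurd h0 h'.not_isSuccLimit, fun _ => h1⟩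
  obtain ⟨c, hc, hc1, hc2⟩ := key
  refine ⟨c, hc.height_lt, fun f => restr_eq_add f (fun r => ⟨fun hr => ?_, ?_⟩) fun r hr => ?_⟩
  · obtain ⟨c', hc', hcr'⟩ := exists_edge_of_expo_ne_zero hv hr
    by_cases hx : Edge x c'
    · exact Or.inl (hx.expo_ne_zero hcr')
    · right
      rwa [hc.of_samePt hc']
      rw [h.edge_iff hv hle, not_and] at hx
      have hx := hx hc'
      rcases zero_or_isSuccOrd_or_isSuccLimit v.height with h0 | h0 | h0
      · exact absurd h0 hv
      · have e := (hc.height_eq h0).symm.trans (hc'.height_eq h0)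
        have e' := Order.add_one_inj.1 e
        refine ⟨e', fun δ hδ => ?_⟩
        rcases ((hc.height_eq h0).trans_le (Order.add_one_le_iff.2 hδ)).eq_or_lt with rfl | h2
        · rw [hc1 h0]
          refine le_antisymm (Order.add_one_le_iff.2 ((edge_succ_iff h0).1 hc').2.2.1) ?_
          by_contra! hlt
          exact hx ⟨fun _ => hp ▸ hlt, fun h' => absurd h' h0.not_isSuccLimit⟩
        · rw [hc.seq_of_lt h2, hc'.seq_of_lt h2]
      · have i := (edge_limit_iff h0).1 hc
        have i' := (edge_limit_iff h0).1 hc'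
        have e' : c.height = c'.height := by
          rw [hc2 h0]
          refine le_antisymm (Order.add_one_le_iff.2 i'.2.1) ?_
          by_contra! hlt
          exact hx ⟨fun h' => absurd h0 h'.not_isSuccLimit, fun _ => hp ▸ hlt⟩
        refine ⟨e', fun δ hδ => ?_⟩
        rcases le_or_gt δ v.height with h2 | h2
        · rw [i.2.2.2.2.1 δ hδ h2, i'.2.2.2.2.1 δ (e' ▸ hδ) h2]
        · rw [hc.seq_of_lt h2, hc'.seq_of_lt h2]
  · rintro (hr | hr)
    · exact h.symm.expo_ne_zero hle hr
    · exact hc.expo_ne_zero hr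
  · by_contra hcr
    obtain ⟨c', hc', hcr'⟩ := exists_edge_of_expo_ne_zero (h.1 ▸ hv) hr
    rw [h.edge_iff hv hle] at hc'
    obtain rfl : c = c' := hc.eq_of_expo_ne_zero hc'.1 hcr hcr' fun _ _ _ _ => rfl
    rcases zero_or_isSuccOrd_or_isSuccLimit v.height with h0 | h0 | h0
    · exact hv h0
    · have := hc'.2.1 h0
      rw [hp, hc1 h0] at this
      exact lt_irrefl _ this
    · have := hc'.2.2 h0
      rw [hp, hc2 h0] at this
      exact lt_irrefl _ this

/-- The vertex that is removed when the parameter is increased to a limit. -/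
theorem exists_split_limit {v x : Vertex α} (h : SamePt x v) (hv : Order.IsSuccLimit v.height)
    (hx : Order.IsSuccLimit x.param) (hp : v.param < x.param) :
    ∃ c : Vertex α, c.height < v.height ∧
      ∀ f : U α 0 → ℕ, restr v f = restr x f + restr c f := by
  have hv0 : v.height ≠ 0 := hv.bot_lt.ne'
  have hx' : Order.IsSuccLimit x.height := h.1 ▸ hv
  have hxv : x.param < v.height := h.1 ▸ x.isParam.2.2 hx'
  let y := v.withParam 0 (IsParam.zero _)
  have hy0 : ∀ δ, δ ≤ v.height → y.seq δ = 0 := fun δ hδ => by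
    rcases hδ.eq_or_lt with rfl | hδ
    · exact v.withParam_param _ _
    · exact y.seq_of_lt hδ
  have hy1 : ∀ δ, v.height < δ → y.seq δ = v.seq δ := (v.withParam_samePt _ _).2
  -- The children of `v` lying below the limit `x.param` are exactly those of one vertex of height
  -- `x.param`.
  let c := mkVertex x.param (hxv.trans v.height_lt) v.param ⟨fun h' => absurd h' hx.bot_lt.ne',
    fun h' => absurd hx h'.not_isSuccLimit, fun _ => hp⟩ y.seq y.seq_mem_zero
  have hc : Order.IsSuccLimit c.height := hx
  have hcp : c.param = v.param := mkVertex_seq_self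
  have hc1 : ∀ δ, x.param < δ → c.seq δ = y.seq δ := fun δ hδ => mkVertex_seq_of_lt hδ
  have edge_c : ∀ d, Edge c d ↔ Edge v d ∧ d.height < x.param := by
    intro d
    rw [edge_limit_iff hc, edge_limit_iff hv]
    constructor
    · rintro ⟨h1, h2, h3, h4, h5, h6⟩
      refine ⟨⟨h1, hcp ▸ h2, h3.trans hxv, h4, fun δ h7 h8 => ?_, fun δ hδ => ?_⟩, h3⟩
      · rcases le_or_gt δ x.param with h9 | h9
        · exact h5 δ h7 h9
        · rw [h6 δ h9, hc1 δ h9, hy0 δ h8]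
      · rw [h6 δ (hxv.trans hδ), hc1 δ (hxv.trans hδ), hy1 δ hδ]
    · rintro ⟨⟨h1, h2, h3, h4, h5, h6⟩, h7⟩
      refine ⟨h1, hcp.symm ▸ h2, h7, h4, fun δ h8 h9 => h5 δ h8 (h9.trans hxv.le),
        fun δ hδ => ?_⟩
      rw [hc1 δ hδ]
      rcases le_or_gt δ v.height with h9 | h9
      · rw [hy0 δ h9, h5 δ (h7.trans hδ) h9]
      · rw [hy1 δ h9, h6 δ h9]
  have edge_x : ∀ d, Edge x d ↔ Edge v d ∧ x.param < d.height := by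
    intro d
    rw [h.edge_iff hv0 hp.le]
    exact and_congr_right fun _ => ⟨fun h' => h'.2 hv,
      fun h' => ⟨fun h'' => absurd hv h''.not_isSuccLimit, fun _ => h'⟩⟩
  refine ⟨c, hxv, fun f => restr_eq_add f (fun r => ⟨fun hr => ?_, ?_⟩) fun r hr => ?_⟩
  · obtain ⟨d, hd, hdr⟩ := exists_edge_of_expo_ne_zero hv0 hr
    rcases lt_trichotomy d.height x.param with h1 | h1 | h1
    · exact Or.inr (((edge_c d).2 ⟨hd, h1⟩).expo_ne_zero hdr)
    -- Children of a vertex of limit height have successor heights, so none sits at the limit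
    -- `x.param` itself.
    · exact absurd hx (h1 ▸ ((edge_limit_iff hv).1 hd).1.not_isSuccLimit)
    · exact Or.inl (((edge_x d).2 ⟨hd, h1⟩).expo_ne_zero hdr)
  · rintro (hr | hr)
    · exact h.symm.expo_ne_zero hp.le hr
    · obtain ⟨d, hd, hdr⟩ := exists_edge_of_expo_ne_zero hc.bot_lt.ne' hr
      exact ((edge_c d).1 hd).1.expo_ne_zero hdr
  · by_contra hcr
    obtain ⟨d, hd, hdr⟩ := exists_edge_of_expo_ne_zero (h.1 ▸ hv0) hr
    obtain ⟨d', hd', hdr'⟩ := exists_edge_of_expo_ne_zero hc.bot_lt.ne' hcr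
    rw [edge_x] at hd
    rw [edge_c] at hd'
    obtain rfl : d = d' := hd.1.eq_of_expo_ne_zero hd'.1 hdr hdr' fun _ _ _ _ => rfl
    exact lt_asymm hd.2 hd'.2

/-- The component is lowered from `ρ` back to that of `v`. Each step, from a successor or from a
limit, restores the support of a single vertex of smaller height. -/
theorem restr_mem_of_withParam {v : Vertex α} {f : U α 0 → ℕ}
    (ih : ∀ c : Vertex α, c.height < v.height → restr c f ∈ Mon α) (ρ : Ordinal.{u})
    (hρ : IsParam v.height ρ) (hle : v.param ≤ ρ) (h : restr (v.withParam ρ hρ) f ∈ Mon α) :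
    restr v f ∈ Mon α := by
  induction ρ using Ordinal.limitRecOn with
  | zero =>
    have : v.param = 0 := le_antisymm hle (zero_le (a := v.param))
    rwa [(v.withParam_samePt 0 hρ).eq ((v.withParam_param 0 hρ).trans this.symm)] at h
  | add_one σ hσ =>
    rcases hle.eq_or_lt with he | hlt
    · rwa [(v.withParam_samePt _ hρ).eq ((v.withParam_param _ hρ).trans he.symm)] at h
    · have hσ' : IsParam v.height σ := hρ.mono (lt_add_one σ).le
      refine hσ hσ' (Order.lt_add_one_iff.1 hlt) ?_
      have hv : v.height ≠ 0 := fun h0 => by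
        have := hρ.1 h0
        rw [this] at hlt
        exact not_lt_bot hlt
      obtain ⟨c, hc, hcf⟩ := exists_split_succ (v := v.withParam σ hσ')
        ((v.withParam_samePt _ hρ).trans (v.withParam_samePt σ hσ').symm) hv
        (by rw [v.withParam_param, v.withParam_param])
      rw [hcf f]
      exact add_mem h (ih c hc)
  | limit ρ hl _ =>
    rcases hle.eq_or_lt with he | hlt
    · rwa [(v.withParam_samePt _ hρ).eq ((v.withParam_param _ hρ).trans he.symm)] at h
    -- An infinite component at the height occurs only at limit heights. One split then leads
    -- directly from the limit to the component of `v`.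
    · have hv : Order.IsSuccLimit v.height := by
        rcases zero_or_isSuccOrd_or_isSuccLimit v.height with h0 | h0 | h0
        · exact absurd (hρ.1 h0) hl.bot_lt.ne'
        · exact absurd (hρ.2.1 h0) (omega0_le_of_isSuccLimit hl).not_gt
        · exact h0
      obtain ⟨c, hc, hcf⟩ := exists_split_limit (v.withParam_samePt ρ hρ) hv
        (by rwa [v.withParam_param]) (by rwa [v.withParam_param])
      rw [hcf f]
      exact add_mem h (ih c hc)

/-- Near the point of `v` the function is a multiple of a vertex. The rest of the support of `v` is
a finite union of supports of lower vertices, handled by induction on the height. -/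
theorem restr_mem {f : U α 0 → ℕ} (hf : IsLocal f) (v : Vertex α) : restr v f ∈ Mon α := by
  obtain ⟨c, w, hw, hc⟩ := hf v
  have key : ∀ x, SamePt x v → w.param ≤ x.param → restr x f ∈ Mon α := by
    intro x hx hp
    have : restr x f = c • expo x := by
      funext r
      rw [Pi.smul_apply, _root_.smul_eq_mul]
      by_cases hr : expo x r = 0
      · rw [restr_of_eq hr, hr, mul_zero]
      · have e := (hw.trans hx.symm).expo_eq hp hr
        rw [restr_of_ne hr, hc r (e ▸ hr), e]
    rw [this]
    exact nsmul_mem (expo_mem x) c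
  rcases le_total w.param v.param with hp | hp
  · exact key v (SamePt.refl v) hp
  · have hpar : IsParam v.height w.param := hw.1 ▸ w.isParam
    refine restr_mem_of_withParam (fun c hlt => restr_mem hf c) w.param hpar hp
      (key _ (v.withParam_samePt _ _) ?_)
    rw [v.withParam_param]
termination_by v.height

/-- The restrictions to the vertices of the cover are peeled off one at a time; each is a monomial
and the remainder stays local. -/
theorem mem_of_isLocal {f : U α 0 → ℕ} (hf : IsLocal f) (s : Finset (Vertex α))
    (hs : ∀ r, f r ≠ 0 → ∃ v ∈ s, expo v r ≠ 0) : f ∈ Mon α := by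
  classical
  induction s using Finset.induction_on generalizing f with
  | empty =>
    have : f = 0 := by
      funext r
      by_contra h
      obtain ⟨v, hv, -⟩ := hs r h
      exact absurd hv (Finset.notMem_empty v)
    rw [this]
    exact zero_mem _
  | insert v s _ ih =>
    have h1 : f = restr v f + (f - restr v f) := by
      funext r
      rw [Pi.add_apply, Pi.sub_apply]
      by_cases hr : expo v r = 0
      · rw [restr_of_eq hr, zero_add, Nat.sub_zero]
      · rw [restr_of_ne hr, Nat.sub_self, add_zero]
    rw [h1]
    refine add_mem (restr_mem hf v) (ih (fun q => ?_) fun r hr => ?_)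
    · obtain ⟨c, hc⟩ := hf q
      obtain ⟨d, hd⟩ := hf.restr v q
      exact ⟨c - d, hc.sub hd⟩
    · rw [Pi.sub_apply] at hr
      by_cases h2 : expo v r = 0
      · rw [restr_of_eq h2, Nat.sub_zero] at hr
        obtain ⟨w, hw, hwr⟩ := hs r hr
        rcases Finset.mem_insert.1 hw with rfl | hw
        · exact absurd h2 hwr
        · exact ⟨w, hw, hwr⟩
      · rw [restr_of_ne h2, Nat.sub_self] at hr
        exact absurd rfl hr

theorem exists_finset_of_mem {f : U α 0 → ℕ} (hf : f ∈ Mon α) :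
    ∃ s : Finset (Vertex α), ∀ r, f r ≠ 0 → ∃ v ∈ s, expo v r ≠ 0 := by
  classical
  induction hf using AddSubmonoid.closure_induction with
  | mem f hf =>
    obtain ⟨v, rfl⟩ := hf
    exact ⟨{v}, fun r hr => ⟨v, Finset.mem_singleton_self v, hr⟩⟩
  | zero => exact ⟨∅, fun r hr => absurd rfl hr⟩
  | add f g _ _ hf hg =>
    obtain ⟨s, hs⟩ := hf
    obtain ⟨t, ht⟩ := hg
    refine ⟨s ∪ t, fun r hr => ?_⟩
    by_cases h : f r = 0
    · obtain ⟨v, hv, h'⟩ := ht r fun h' => hr (by rw [Pi.add_apply, h, h'])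
      exact ⟨v, Finset.mem_union_right _ hv, h'⟩
    · obtain ⟨v, hv, h'⟩ := hs r h
      exact ⟨v, Finset.mem_union_left _ hv, h'⟩

theorem inf_mem {f g : U α 0 → ℕ} (hf : f ∈ Mon α) (hg : g ∈ Mon α) : f ⊓ g ∈ Mon α := by
  obtain ⟨s, hs⟩ := exists_finset_of_mem hf
  refine mem_of_isLocal (fun q => ?_) s fun r hr => hs r fun h => hr ?_
  · obtain ⟨c, hc⟩ := isLocal_of_mem hf q
    obtain ⟨d, hd⟩ := isLocal_of_mem hg q
    exact ⟨_, hc.inf hd⟩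
  · rw [Pi.inf_apply, h]
    exact Nat.zero_min _

/-- This makes the pointwise order on monomials coincide with divisibility. -/
theorem tsub_mem_mon {f g : U α 0 → ℕ} (hf : f ∈ Mon α) (hg : g ∈ Mon α) : f - g ∈ Mon α := by
  obtain ⟨s, hs⟩ := exists_finset_of_mem hf
  refine mem_of_isLocal (fun q => ?_) s fun r hr => hs r fun h => hr ?_
  · obtain ⟨c, hc⟩ := isLocal_of_mem hf q
    obtain ⟨d, hd⟩ := isLocal_of_mem hg q
    exact ⟨_, hc.sub hd⟩
  · rw [Pi.sub_apply, h, Nat.zero_sub]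

end Monoid

/- ### The valuations of the monoid of monomials -/

section Val

variable {α : Ordinal.{u}}

/-- The valuation of the monoid of monomials at the point of the vertex `q`. -/
def val (q : Vertex α) (m : Mon α) : ℕ := Classical.choose (isLocal_of_mem m.2 q)

theorem isCoef_val (q : Vertex α) (m : Mon α) : IsCoef q m.1 (val q m) :=
  Classical.choose_spec (isLocal_of_mem m.2 q)

theorem val_eq_of_isCoef {q : Vertex α} {m : Mon α} {c : ℕ} (h : IsCoef q m.1 c) : val q m = c :=
  (isCoef_val q m).unique h

theorem val_zero (q : Vertex α) : val q 0 = 0 := val_eq_of_isCoef (IsCoef.zero q)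

theorem val_add (q : Vertex α) (m n : Mon α) : val q (m + n) = val q m + val q n :=
  val_eq_of_isCoef ((isCoef_val q m).add (isCoef_val q n))

theorem val_nsmul (q : Vertex α) (k : ℕ) (m : Mon α) : val q (k • m) = k * val q m := by
  induction k with
  | zero => rw [zero_nsmul, val_zero, zero_mul]
  | succ k ih => rw [succ_nsmul, val_add, ih, add_mul, one_mul]

theorem SamePt.val_eq {p q : Vertex α} (h : SamePt p q) (m : Mon α) : val p m = val q m := by
  obtain ⟨w, hw, h'⟩ := isCoef_val p m
  exact (val_eq_of_isCoef ⟨w, hw.trans h, h'⟩).symm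

theorem exists_add_of_le {m n : Mon α} (h : m.1 ≤ n.1) : ∃ a, n = m + a :=
  ⟨⟨n.1 - m.1, tsub_mem_mon n.2 m.2⟩, Subtype.ext (add_tsub_cancel_of_le h).symm⟩

theorem le_mon_add_right (m n : Mon α) : m.1 ≤ (m + n).1 := fun r =>
  Nat.le_add_right (m.1 r) (n.1 r)

theorem val_mono (q : Vertex α) {m n : Mon α} (h : m.1 ≤ n.1) : val q m ≤ val q n := by
  obtain ⟨a, rfl⟩ := exists_add_of_le h
  rw [val_add]
  exact Nat.le_add_right _ _

/-- The vertex that gives the value of the valuation at a point of height zero. -/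
def baseVertex (hα : 0 < α) (r : U α 0) : Vertex α := ⟨0, r.1, hα, r.2⟩

theorem expo_baseVertex (hα : 0 < α) (r s : U α 0) : expo (baseVertex hα r) s ≠ 0 ↔ r = s := by
  rw [expo_of_height_eq_zero rfl]
  exact Subtype.ext_iff.symm

theorem val_baseVertex (hα : 0 < α) (r : U α 0) (m : Mon α) :
    val (baseVertex hα r) m = m.1 r := by
  refine val_eq_of_isCoef ⟨_, SamePt.refl _, fun s hs => ?_⟩
  rw [expo_eq_one rfl hs, mul_one]
  rw [expo_baseVertex] at hs
  rw [hs]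

/-- The valuations at the points of height zero are the individual exponents. -/
theorem le_of_val_le (hα : 0 < α) {m n : Mon α} (h : ∀ q, val q m ≤ val q n) : m.1 ≤ n.1 := by
  intro r
  rw [← val_baseVertex hα, ← val_baseVertex hα]
  exact h _

/-- A vertex as a monomial. -/
def Vertex.mon (v : Vertex α) : Mon α := ⟨expo v, expo_mem v⟩

theorem SamePt.val_mon {q v : Vertex α} (h : SamePt q v) : val q v.mon = 1 :=
  val_eq_of_isCoef ⟨v, h.symm, fun _ _ => (one_mul _).symm⟩

theorem val_mon_eq_zero_or (q v : Vertex α) :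
    val q v.mon = 0 ∨ q.height < v.height ∨ SamePt q v := by
  obtain ⟨c, hc, h⟩ := exists_isCoef_expo v q
  rwa [val_eq_of_isCoef (m := v.mon) hc]

theorem SamePt.mon_le {v w : Vertex α} (h : SamePt w v) (hp : w.param ≤ v.param) :
    v.mon.1 ≤ w.mon.1 := by
  intro r
  by_cases hr : expo v r = 0
  · change expo v r ≤ _
    rw [hr]
    exact Nat.zero_le _
  · exact (h.expo_eq hp hr).ge

theorem exists_eq_nsmul_add (q : Vertex α) (m : Mon α) :
    ∃ w, SamePt w q ∧ ∃ g, m = val q m • w.mon + g ∧ val q g = 0 := by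
  obtain ⟨w, hw, h⟩ := isCoef_val q m
  have hle : (val q m • w.mon).1 ≤ m.1 := by
    intro r
    change val q m * expo w r ≤ _
    by_cases hr : expo w r = 0
    · rw [hr, mul_zero]
      exact Nat.zero_le _
    · exact (h r hr).ge
  obtain ⟨g, hg⟩ := exists_add_of_le hle
  refine ⟨w, hw, g, hg, ?_⟩
  have h' := congrArg (val q) hg
  rw [val_add, val_nsmul, hw.symm.val_mon, mul_one] at h'
  omega

theorem exists_mon_le {q : Vertex α} {m : Mon α} (h : 0 < val q m) :
    ∃ w, SamePt w q ∧ w.mon.1 ≤ m.1 := by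
  obtain ⟨w, hw, g, hg, -⟩ := exists_eq_nsmul_add q m
  refine ⟨w, hw, ?_⟩
  obtain ⟨k, hk⟩ := Nat.exists_eq_succ_of_ne_zero h.ne'
  rw [hk, succ_nsmul', add_assoc] at hg
  rw [hg]
  exact le_mon_add_right _ _

/-- Monomials without common factors. -/
def Disj (m n : Mon α) : Prop := m.1 ⊓ n.1 = 0

theorem Disj.symm {m n : Mon α} (h : Disj m n) : Disj n m := (inf_comm _ _).trans h

theorem Disj.val {m n : Mon α} (h : Disj m n) (q : Vertex α) : val q m = 0 ∨ val q n = 0 := by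
  have h1 := (isCoef_val q m).inf (isCoef_val q n)
  rw [show m.1 ⊓ n.1 = 0 from h] at h1
  have h2 : AlmostDedekind.val q m ⊓ AlmostDedekind.val q n = 0 := h1.unique (IsCoef.zero q)
  rcases le_total (AlmostDedekind.val q m) (AlmostDedekind.val q n) with h3 | h3
  · rw [inf_eq_left.2 h3] at h2
    exact Or.inl h2
  · rw [inf_eq_right.2 h3] at h2
    exact Or.inr h2

theorem exists_disj_mon {q : Vertex α} {m : Mon α} (h : val q m = 0) :
    ∃ w, SamePt w q ∧ Disj m w.mon := by
  obtain ⟨w, hw, h'⟩ := isCoef_val q m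
  refine ⟨w, hw, funext fun r => ?_⟩
  rw [Pi.inf_apply]
  by_cases hr : expo w r = 0
  · change min _ (expo w r) = 0
    rw [hr]
    exact Nat.min_zero _
  · rw [h' r hr, h, zero_mul]
    exact Nat.zero_min _

theorem exists_gcd (m n : Mon α) : ∃ d a b, m = d + a ∧ n = d + b ∧ Disj a b ∧
    d.1 = m.1 ⊓ n.1 := by
  let d : Mon α := ⟨m.1 ⊓ n.1, inf_mem m.2 n.2⟩
  obtain ⟨a, ha⟩ := exists_add_of_le (m := d) (n := m) inf_le_left
  obtain ⟨b, hb⟩ := exists_add_of_le (m := d) (n := n) inf_le_right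
  refine ⟨d, a, b, ha, hb, funext fun r => ?_, rfl⟩
  have h1 : m.1 r = min (m.1 r) (n.1 r) + a.1 r := congrFun (congrArg Subtype.val ha) r
  have h2 : n.1 r = min (m.1 r) (n.1 r) + b.1 r := congrFun (congrArg Subtype.val hb) r
  change min (a.1 r) (b.1 r) = 0
  omega

theorem disj_self {m : Mon α} (h : Disj m m) : m = 0 :=
  Subtype.ext ((inf_idem _).symm.trans h)

theorem Disj.mono {m n m' : Mon α} (h : Disj m n) (h' : m'.1 ≤ m.1) : Disj m' n :=
  le_antisymm ((inf_le_inf_right _ h').trans h.le) fun _ => Nat.zero_le _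

/-- A property of monomials that is closed under products holds for `m` if it holds for all
vertices that divide `m`. -/
theorem mon_induction {p : Mon α → Prop} (h0 : p 0) (hadd : ∀ m n, p m → p n → p (m + n))
    (m : Mon α) (h : ∀ v : Vertex α, v.mon.1 ≤ m.1 → p v.mon) : p m := by
  obtain ⟨f, hf⟩ := m
  induction hf using AddSubmonoid.closure_induction with
  | mem f hf =>
    obtain ⟨v, rfl⟩ := hf
    exact h v le_rfl
  | zero => exact h0
  | add f g hf hg hf' hg' =>
    exact hadd ⟨f, hf⟩ ⟨g, hg⟩
      (hf' fun v hv => h v (hv.trans (le_mon_add_right ⟨f, hf⟩ ⟨g, hg⟩)))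
      (hg' fun v hv => h v (hv.trans ((le_mon_add_right ⟨g, hg⟩ ⟨f, hf⟩).trans
        (add_comm g f).le)))

/-- The point `q` is that of a child of `p`, where the squares in the definition of `p` produce the
value 2. At a limit height the children have arbitrarily large heights below it. -/
theorem exists_two_le_val {p : Vertex α} {β : Ordinal.{u}} (h : β < p.height) :
    ∃ q : Vertex α, β ≤ q.height ∧ 2 ≤ val q p.mon := by
  have key : ∃ q : Vertex α, β ≤ q.height ∧ Edge p q := by
    rcases zero_or_isSuccOrd_or_isSuccLimit p.height with h0 | ⟨γ, h0⟩ | h0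
    · exact absurd h (h0 ▸ not_lt_bot)
    · obtain ⟨q, hq, h1, -⟩ := edge_mkVertex_succ h0
      exact ⟨q, h1 ▸ Order.lt_add_one_iff.1 (h0 ▸ h), hq⟩
    · obtain ⟨q, hq, h1⟩ := edge_mkVertex_limit h0 (γ := max β p.param + 1) ⟨_, rfl⟩
        (Order.lt_add_one_iff.2 (le_max_right _ _))
        (h0.add_one_lt (max_lt h (p.isParam.2.2 h0)))
      exact ⟨q, h1 ▸ (le_max_left _ _).trans (lt_add_one _).le, hq⟩
  obtain ⟨q, hq, he⟩ := key
  exact ⟨q, hq, (val_eq_of_isCoef (m := p.mon)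
    ⟨q, SamePt.refl q, fun r hr => he.expo_eq hr⟩).ge⟩

end Val

/- ### Domains whose divisibility is described by the monoid of monomials -/

section MonRing

variable {α : Ordinal.{u}}

/-- A domain `T` in which every nonzero element is associated to a monomial and in which
divisibility of monomials is governed by the valuations at the points of height at least `β`. -/
structure IsMonRing (β : Ordinal.{u}) {T : Type w} [CommRing T] (x : Mon α → T) : Prop where
  map_zero : x 0 = 1
  map_add : ∀ m n, x (m + n) = x m * x n
  ne_zero : ∀ m, x m ≠ 0
  exists_associated : ∀ t, t ≠ 0 → ∃ m, Associated (x m) t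
  isCoprime : ∀ m n, Disj m n → IsCoprime (x m) (x n)
  dvd_iff : ∀ m n, x m ∣ x n ↔ ∀ q : Vertex α, β ≤ q.height → val q m ≤ val q n

/-- The ideal generated by the vertices at the point of `p`. -/
def ptIdeal {T : Type w} [CommRing T] (x : Mon α → T) (p : Vertex α) : Ideal T :=
  Ideal.span {t | ∃ v, SamePt v p ∧ x v.mon = t}

variable {β : Ordinal.{u}} {T : Type w} [CommRing T] {x : Mon α → T}

namespace IsMonRing

theorem map_nsmul (hx : IsMonRing β x) (k : ℕ) (m : Mon α) : x (k • m) = x m ^ k := by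
  induction k with
  | zero => rw [zero_nsmul, pow_zero, hx.map_zero]
  | succ k ih => rw [succ_nsmul, hx.map_add, ih, pow_succ]

theorem dvd_of_le (hx : IsMonRing β x) {m n : Mon α} (h : m.1 ≤ n.1) : x m ∣ x n :=
  (hx.dvd_iff m n).2 fun q _ => val_mono q h

theorem associated_iff [IsDomain T] (hx : IsMonRing β x) (m n : Mon α) :
    Associated (x m) (x n) ↔ ∀ q : Vertex α, β ≤ q.height → val q m = val q n := by
  rw [← dvd_dvd_iff_associated, hx.dvd_iff, hx.dvd_iff]
  exact ⟨fun h q hq => (h.1 q hq).antisymm (h.2 q hq),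
    fun h => ⟨fun q hq => (h q hq).le, fun q hq => (h q hq).ge⟩⟩

theorem mem_ptIdeal (hx : IsMonRing β x) {p : Vertex α} {t : T} :
    t ∈ ptIdeal x p ↔ ∃ v, SamePt v p ∧ x v.mon ∣ t := by
  constructor
  · intro ht
    induction ht using Submodule.span_induction with
    | mem t ht =>
      obtain ⟨v, hv, rfl⟩ := ht
      exact ⟨v, hv, dvd_rfl⟩
    | zero => exact ⟨p, SamePt.refl p, dvd_zero _⟩
    | add s t _ _ hs ht =>
      obtain ⟨v, hv, hvs⟩ := hs
      obtain ⟨w, hw, hwt⟩ := ht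
      obtain ⟨y, hy, h1, h2⟩ := hv.exists_le_le hw
      exact ⟨y, hy, dvd_add ((hx.dvd_of_le ((hv.trans hy.symm).mon_le h1)).trans hvs)
        ((hx.dvd_of_le ((hw.trans hy.symm).mon_le h2)).trans hwt)⟩
    | smul a t _ ht =>
      obtain ⟨v, hv, hvt⟩ := ht
      exact ⟨v, hv, hvt.mul_left a⟩
  · rintro ⟨v, hv, hvt⟩
    exact Ideal.mem_of_dvd _ hvt (Ideal.subset_span ⟨v, hv, rfl⟩)

theorem mon_mem_ptIdeal (hx : IsMonRing β x) {p : Vertex α} (hp : β ≤ p.height) {m : Mon α} :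
    x m ∈ ptIdeal x p ↔ 0 < val p m := by
  rw [hx.mem_ptIdeal]
  constructor
  · rintro ⟨v, hv, h⟩
    have := (hx.dvd_iff _ _).1 h p hp
    rw [hv.symm.val_mon] at this
    exact this
  · intro h
    obtain ⟨v, hv, h'⟩ := exists_mon_le h
    exact ⟨v, hv, hx.dvd_of_le h'⟩

theorem mem_iff_of_associated {I : Ideal T} {s t : T} (h : Associated s t) : s ∈ I ↔ t ∈ I :=
  ⟨Ideal.mem_of_dvd I h.dvd, Ideal.mem_of_dvd I h.symm.dvd⟩

/-- A monomial outside the ideal has value zero at `p`, hence is disjoint from, and so comaximal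
with, some vertex at `p`. -/
theorem ptIdeal_isMaximal (hx : IsMonRing β x) {p : Vertex α} (hp : β ≤ p.height) :
    (ptIdeal x p).IsMaximal := by
  rw [Ideal.isMaximal_iff]
  constructor
  · rw [← hx.map_zero, hx.mon_mem_ptIdeal hp, val_zero]
    exact lt_irrefl _
  · intro J t hJ ht htJ
    have ht0 : t ≠ 0 := fun h => ht (h ▸ zero_mem _)
    obtain ⟨m, hm⟩ := hx.exists_associated t ht0
    rw [← mem_iff_of_associated hm, hx.mon_mem_ptIdeal hp, not_lt, Nat.le_zero] at ht
    rw [← mem_iff_of_associated hm] at htJ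
    obtain ⟨v, hv, hd⟩ := exists_disj_mon ht
    obtain ⟨a, b, h⟩ := hx.isCoprime _ _ hd
    rw [← h]
    exact J.add_mem (J.mul_mem_left a htJ)
      (J.mul_mem_left b (hJ (Ideal.subset_span ⟨v, hv, rfl⟩)))

theorem isBezout (hx : IsMonRing β x) : IsBezout T := by
  rw [IsBezout.iff_span_pair_isPrincipal]
  intro s t
  by_cases hs : s = 0
  · refine ⟨⟨t, ?_⟩⟩
    rw [hs, Ideal.span_pair_comm, Ideal.span_pair_zero, Ideal.submodule_span_eq]
  by_cases ht : t = 0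
  · refine ⟨⟨s, ?_⟩⟩
    rw [ht, Ideal.span_pair_zero, Ideal.submodule_span_eq]
  obtain ⟨m, hm⟩ := hx.exists_associated s hs
  obtain ⟨n, hn⟩ := hx.exists_associated t ht
  obtain ⟨d, a, b, rfl, rfl, hd, -⟩ := exists_gcd m n
  refine ⟨⟨x d, ?_⟩⟩
  rw [Ideal.submodule_span_eq]
  apply le_antisymm
  · rw [Ideal.span_le]
    rintro y (rfl | rfl)
    · exact Ideal.mem_span_singleton.2 ((hx.dvd_of_le (le_mon_add_right _ _)).trans hm.dvd)
    · exact Ideal.mem_span_singleton.2 ((hx.dvd_of_le (le_mon_add_right _ _)).trans hn.dvd)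
  · rw [Ideal.span_singleton_le_iff_mem]
    obtain ⟨e, f, h⟩ := hx.isCoprime _ _ hd
    have key : x d = e * x (d + a) + f * x (d + b) := by
      rw [hx.map_add, hx.map_add]
      linear_combination (- x d) * h
    rw [key]
    refine add_mem (Ideal.mul_mem_left _ _ ?_) (Ideal.mul_mem_left _ _ ?_)
    · exact (mem_iff_of_associated hm).2 (Ideal.subset_span (Or.inl rfl))
    · exact (mem_iff_of_associated hn).2 (Ideal.subset_span (Or.inr rfl))

/-- At height `β` the vertex `p` has only the values 0 and 1 at the points that count, so it
generates a radical ideal. Above `β`, every monomial in the ideal has value at least 2 at some point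
that counts. -/
theorem isCritical_ptIdeal_iff [IsDomain T] (hx : IsMonRing β x) {p : Vertex α}
    (hp : β ≤ p.height) : IsCritical (ptIdeal x p) ↔ β < p.height := by
  constructor
  · rintro ⟨-, h⟩
    refine hp.lt_of_ne fun he => h (Ideal.span {x p.mon}) ?_ ?_ (Submodule.fg_span_singleton _) ?_
    · rw [Ideal.span_singleton_le_iff_mem]
      exact Ideal.subset_span ⟨p, SamePt.refl p, rfl⟩
    · rw [Ne, Ideal.span_singleton_eq_bot]
      exact hx.ne_zero _
    · rintro t ⟨n, hn⟩
      by_cases ht : t = 0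
      · rw [ht]
        exact zero_mem _
      obtain ⟨m, hm⟩ := hx.exists_associated t ht
      rw [← mem_iff_of_associated hm, Ideal.mem_span_singleton, hx.dvd_iff]
      rw [← mem_iff_of_associated (hm.pow_pow (n := n)), Ideal.mem_span_singleton,
        ← hx.map_nsmul, hx.dvd_iff] at hn
      intro q hq
      have h1 := hn q hq
      rw [val_nsmul] at h1
      rcases val_mon_eq_zero_or q p with h0 | h0 | h0
      · rw [h0]; exact Nat.zero_le _
      · exact absurd (he ▸ hq) h0.not_ge
      · rw [h0.val_mon] at h1 ⊢
        exact Nat.pos_of_ne_zero (right_ne_zero_of_mul (Nat.one_le_iff_ne_zero.1 h1))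
  · intro hlt
    refine ⟨hx.ptIdeal_isMaximal hp, fun I hI h0 hfg hrad => ?_⟩
    have := hx.isBezout
    obtain ⟨⟨t, ht⟩⟩ := IsBezout.isPrincipal_of_FG I hfg
    rw [Ideal.submodule_span_eq] at ht
    subst ht
    rw [Ne, Ideal.span_singleton_eq_bot] at h0
    obtain ⟨m, hm⟩ := hx.exists_associated t h0
    rw [Ideal.span_singleton_le_iff_mem, ← mem_iff_of_associated hm,
      hx.mon_mem_ptIdeal hp] at hI
    obtain ⟨v, hv, g, hg, hgp⟩ := exists_eq_nsmul_add p m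
    obtain ⟨q, hq, hq2⟩ := exists_two_le_val (p := v) (β := β) (hv.1 ▸ hlt)
    have hk : 2 ≤ val q m := by
      have : val q m = val p m * val q v.mon + val q g := by
        conv_lhs => rw [hg]
        rw [val_add, val_nsmul]
      rw [this]
      exact (hq2.trans (Nat.le_mul_of_pos_left _ hI)).trans (Nat.le_add_right _ _)
    obtain ⟨w, hw, c, hc, hcq⟩ := exists_eq_nsmul_add q m
    obtain ⟨k, hk'⟩ := Nat.exists_eq_add_of_le' hk
    rw [hk'] at hc
    -- Here `m` is `(k + 2) • w.mon + c`. Removing one copy of `w` gives a monomial whose square is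
    -- still divisible by `m`, but whose value at `q` is too small to be divisible by `m`.
    have hmem : x ((k + 1) • w.mon + c) ∈ Ideal.span {t} := by
      refine hrad ⟨2, ?_⟩
      rw [← hx.map_nsmul, Ideal.mem_span_singleton]
      refine hm.symm.dvd.trans (hx.dvd_of_le ?_)
      have : 2 • ((k + 1) • w.mon + c) = m + (k • w.mon + c) := by
        rw [hc, smul_add, smul_smul, add_add_add_comm, ← add_smul, two_smul ℕ c]
        congr 2
        omega
      rw [this]
      exact le_mon_add_right _ _
    rw [Ideal.mem_span_singleton] at hmem
    have h3 := (hx.dvd_iff _ _).1 (hm.dvd.trans hmem) q hq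
    rw [val_add, val_nsmul, hw.symm.val_mon, hcq, hk'] at h3
    omega

/-- In the absence of a height bound, every maximal ideal is one of the ideals `ptIdeal x p`. -/
theorem exists_eq_ptIdeal (hx : IsMonRing 0 x) (hα : 0 < α) (M : Ideal T)
    [hM : M.IsMaximal] : ∃ p, M = ptIdeal x p := by
  have hv : ∃ v : Vertex α, x v.mon ∈ M := by
    have p₀ : Vertex α := ⟨0, 0, hα, zero_mem_U 0⟩
    have hmax := hx.ptIdeal_isMaximal (p := p₀) zero_le
    have h0 : M ≠ ⊥ := by
      rintro rfl
      have := hM.eq_of_le hmax.ne_top bot_le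
      have h1 : x p₀.mon ∈ ptIdeal x p₀ := Ideal.subset_span ⟨p₀, SamePt.refl _, rfl⟩
      rw [← this] at h1
      exact hx.ne_zero _ h1
    obtain ⟨t, ht, ht0⟩ := Submodule.exists_mem_ne_zero_of_ne_bot h0
    obtain ⟨m, hm⟩ := hx.exists_associated t ht0
    rw [← mem_iff_of_associated hm] at ht
    by_contra! hv
    refine mon_induction (p := fun m => x m ∉ M) ?_ (fun a b ha hb hab => ?_) m
      (fun v _ => hv v) ht
    · rw [hx.map_zero]
      exact fun h => hM.ne_top ((Ideal.eq_top_iff_one _).2 h)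
    · rw [hx.map_add] at hab
      exact (hM.isPrime.mem_or_mem hab).elim ha hb
  -- A vertex of minimal height in `M` determines the point. For another vertex `w` there, the
  -- cofactor `a` of the gcd in `v` involves only vertices of lower height, so `a ∉ M`; hence the
  -- gcd, and with it `w`, lies in `M`.
  obtain ⟨v, hvM, hmin⟩ : ∃ v : Vertex α, x v.mon ∈ M ∧
      ∀ w : Vertex α, x w.mon ∈ M → v.height ≤ w.height := by
    obtain ⟨v, hv, hmin⟩ := (InvImage.wf (fun v : Vertex α => v.height) wellFounded_lt).has_min
      {v : Vertex α | x v.mon ∈ M} hv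
    exact ⟨v, hv, fun w hw => not_lt.1 (hmin w hw)⟩
  refine ⟨v, ((hx.ptIdeal_isMaximal (p := v) zero_le).eq_of_le hM.ne_top ?_).symm⟩
  rw [ptIdeal, Ideal.span_le]
  rintro _ ⟨w, hw, rfl⟩
  obtain ⟨d, a, b, hva, hwb, hd, -⟩ := exists_gcd v.mon w.mon
  have ha : val v a = 0 := by
    have h1 := congrArg (val v) hva
    have h2 := congrArg (val v) hwb
    rw [(SamePt.refl v).val_mon, val_add] at h1
    rw [hw.symm.val_mon, val_add] at h2
    rcases hd.val v with h | h <;> omega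
  rw [hva, hx.map_add] at hvM
  rw [SetLike.mem_coe, hwb, hx.map_add]
  refine Ideal.mul_mem_right _ _ ((hM.isPrime.mem_or_mem hvM).resolve_right ?_)
  refine mon_induction (p := fun m => x m ∉ M) ?_ (fun a b ha hb hab => ?_) a fun u hu huM => ?_
  · rw [hx.map_zero]
    exact fun h => hM.ne_top ((Ideal.eq_top_iff_one _).2 h)
  · rw [hx.map_add] at hab
    exact (hM.isPrime.mem_or_mem hab).elim ha hb
  · have h1 := val_mono u hu
    rw [(SamePt.refl u).val_mon] at h1
    have h2 : val u v.mon ≠ 0 := by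
      rw [hva, val_add]
      omega
    rcases (val_mon_eq_zero_or u v).resolve_left h2 with h3 | h3
    · exact h3.not_ge (hmin u huM)
    · rw [h3.val_eq, ha] at h1
      omega

theorem samePt_of_ptIdeal_eq (hx : IsMonRing 0 x) {p q : Vertex α}
    (h : ptIdeal x p = ptIdeal x q) : SamePt p q := by
  have key : ∀ {p q : Vertex α}, ptIdeal x p = ptIdeal x q →
      q.height < p.height ∨ SamePt q p := by
    intro p q h
    have h1 : x p.mon ∈ ptIdeal x q := h ▸ Ideal.subset_span ⟨p, SamePt.refl p, rfl⟩
    rw [hx.mon_mem_ptIdeal zero_le] at h1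
    exact (val_mon_eq_zero_or q p).resolve_left h1.ne'
  rcases key h with h1 | h1
  · exact ((key h.symm).resolve_left h1.not_gt)
  · exact h1.symm

end IsMonRing

end MonRing

/- ### Localizations, overrings and the SP-rank -/

section Overring

variable {α : Ordinal.{u}} {D : Type w} [CommRing D] {x : Mon α → D}

namespace IsMonRing

/-- Monomials of equal value at `p` become associated in the localization, since cancelling their
gcd leaves units. So the vertex `p` is a uniformizer. -/
theorem isDiscreteValuationRing [IsDomain D] (hx : IsMonRing 0 x) (hα : 0 < α) (M : Ideal D)
    [hM : M.IsMaximal] : IsDiscreteValuationRing (Localization.AtPrime M) := by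
  obtain ⟨p, hp⟩ := hx.exists_eq_ptIdeal hα M
  have hinj : Function.Injective (algebraMap D (Localization.AtPrime M)) :=
    IsLocalization.injective _ M.primeCompl_le_nonZeroDivisors
  have hdom : IsDomain (Localization.AtPrime M) :=
    IsLocalization.isDomain_localization M.primeCompl_le_nonZeroDivisors
  let y : Mon α → Localization.AtPrime M := fun m => algebraMap D _ (x m)
  have hy : ∀ m n, y (m + n) = y m * y n := fun m n => by
    simp only [y, hx.map_add, map_mul]
  have hunit : ∀ m, val p m = 0 → IsUnit (y m) := by
    intro m hm
    refine IsLocalization.map_units (M := M.primeCompl) _ (⟨x m, ?_⟩ : M.primeCompl)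
    change x m ∉ M
    rw [hp, hx.mon_mem_ptIdeal zero_le, hm]
    exact lt_irrefl _
  have hassoc : ∀ m n, val p m = val p n → Associated (y m) (y n) := by
    intro m n h
    obtain ⟨d, a, b, rfl, rfl, hd, -⟩ := exists_gcd m n
    rw [val_add, val_add] at h
    have hab := Nat.add_left_cancel h
    have ha : val p a = 0 := (hd.val p).elim id fun h => hab.trans h
    rw [hy, hy]
    exact (Associated.refl _).mul_mul
      ((associated_one_iff_isUnit.2 (hunit a ha)).trans
        (associated_one_iff_isUnit.2 (hunit b (hab ▸ ha))).symm)
  have hpow : ∀ z : Localization.AtPrime M, z ≠ 0 → ∃ n, Associated (y p.mon ^ n) z := by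
    intro z hz
    obtain ⟨a, s, rfl⟩ := IsLocalization.exists_mk'_eq M.primeCompl z
    have ha : a ≠ 0 := by
      rintro rfl
      exact hz (IsLocalization.mk'_zero _)
    obtain ⟨m, hm⟩ := hx.exists_associated a ha
    refine ⟨val p m, ?_⟩
    have h1 : y p.mon ^ val p m = y (val p m • p.mon) := by
      simp only [y, hx.map_nsmul, map_pow]
    rw [h1]
    refine (hassoc _ m ?_).trans ((hm.map (algebraMap D (Localization.AtPrime M))).trans ?_)
    · rw [val_nsmul, (SamePt.refl p).val_mon, mul_one]
    · refine ⟨(IsLocalization.map_units (M := M.primeCompl) _ s).unit⁻¹, ?_⟩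
      rw [Units.mul_inv_eq_iff_eq_mul]
      exact (IsLocalization.mk'_spec _ a s).symm
  have hnu : ¬ IsUnit (y p.mon) := by
    intro h
    rw [IsLocalization.AtPrime.isUnit_to_map_iff _ M] at h
    exact h (hp ▸ Ideal.subset_span ⟨p, SamePt.refl p, rfl⟩)
  have h0 : y p.mon ≠ 0 := fun h => hx.ne_zero p.mon (hinj (h.trans (_root_.map_zero _).symm))
  refine IsDiscreteValuationRing.ofHasUnitMulPowIrreducibleFactorization
    ⟨y p.mon, ⟨hnu, fun a b hab => ?_⟩, fun {z} hz => hpow z hz⟩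
  have ha0 : a ≠ 0 := fun h => h0 (by rw [hab, h, zero_mul])
  have hb0 : b ≠ 0 := fun h => h0 (by rw [hab, h, mul_zero])
  obtain ⟨i, hi⟩ := hpow a ha0
  obtain ⟨j, hj⟩ := hpow b hb0
  rcases Nat.eq_zero_or_pos i with rfl | hi0
  · exact Or.inl (associated_one_iff_isUnit.1 (by simpa using hi.symm))
  rcases Nat.eq_zero_or_pos j with rfl | hj0
  · exact Or.inr (associated_one_iff_isUnit.1 (by simpa using hj.symm))
  exfalso
  have h1 : Associated (y p.mon ^ (i + j)) (y p.mon) := by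
    rw [pow_add]
    nth_rewrite 3 [hab]
    exact hi.mul_mul hj
  obtain ⟨k, hk⟩ := Nat.exists_eq_add_of_le' (show 2 ≤ i + j by omega)
  rw [hk] at h1
  obtain ⟨c, hc⟩ := h1.dvd
  refine hnu (IsUnit.of_mul_eq_one (y p.mon ^ k * c) (mul_left_cancel₀ h0 ?_))
  rw [mul_one]
  exact (by ring : y p.mon * (y p.mon * (y p.mon ^ k * c)) = y p.mon ^ (k + 2) * c).trans hc.symm

theorem isAlmostDedekindDomain [IsDomain D] (hx : IsMonRing 0 x) (hα : 0 < α) :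
    IsAlmostDedekindDomain D :=
  ⟨inferInstance, fun M _ => hx.isDiscreteValuationRing hα M⟩

variable (x) in
/-- The maximal ideals that belong to the points of height at least `β`. -/
def ptSet (β : Ordinal.{u}) : Set (MaximalSpectrum D) :=
  {M | ∃ p : Vertex α, β ≤ p.height ∧ M.asIdeal = ptIdeal x p}

/-- Every nonzero fraction is a unit times a reduced fraction of monomials. -/
theorem exists_reduced [IsDomain D] (hx : IsMonRing 0 x) {k : FractionRing D} (hk : k ≠ 0) :
    ∃ (u : Dˣ) (a b : Mon α), Disj a b ∧
      k * algebraMap D _ (x b) = algebraMap D _ (u * x a) := by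
  obtain ⟨c, s, hs, rfl⟩ := IsFractionRing.div_surjective (A := D) k
  have hs0 : s ≠ 0 := nonZeroDivisors.ne_zero hs
  have hc0 : c ≠ 0 := by
    rintro rfl
    exact hk (by rw [_root_.map_zero, _root_.zero_div])
  obtain ⟨m, u, rfl⟩ := hx.exists_associated c hc0
  obtain ⟨n, w, rfl⟩ := hx.exists_associated s hs0
  obtain ⟨d, a, b, rfl, rfl, hd, -⟩ := exists_gcd m n
  refine ⟨u * w⁻¹, a, b, hd, ?_⟩
  have hs1 : algebraMap D (FractionRing D) (x (d + b) * w) ≠ 0 := by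
    rwa [Ne, FaithfulSMul.algebraMap_eq_zero_iff]
  rw [div_mul_eq_mul_div, div_eq_iff hs1, ← map_mul, ← map_mul, hx.map_add, hx.map_add]
  congr 1
  rw [Units.val_mul]
  have hw : (↑w⁻¹ : D) * w = 1 := w.inv_mul
  linear_combination (- x d * x a * u * x b) * hw

/-! ### The overrings `T_β` and the critical sets -/

theorem mem_overring_iff {C : Set (MaximalSpectrum D)} {k : FractionRing D} :
    k ∈ overring C ↔ ∀ M ∈ C, k ∈ localizationAt M := by
  simp only [overring, Algebra.mem_iInf]

/-- Membership in the localization at `p` allows no pole there, and in a reduced fraction a factor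
of the denominator at `p` cannot be cancelled by the numerator. -/
theorem val_eq_zero_of_mem [IsDomain D] (hx : IsMonRing 0 x) {β : Ordinal.{u}}
    {k : FractionRing D} (hk : k ≠ 0) (hmem : k ∈ overring (ptSet x β)) {u : Dˣ} {a b : Mon α}
    (hab : Disj a b) (h : k * algebraMap D _ (x b) = algebraMap D _ (u * x a))
    {p : Vertex α} (hp : β ≤ p.height) : val p b = 0 := by
  have hinj := FaithfulSMul.algebraMap_injective D (FractionRing D)
  obtain ⟨c, s, hs, hcs⟩ := mem_overring_iff.1 hmem
    ⟨ptIdeal x p, hx.ptIdeal_isMaximal zero_le⟩ ⟨p, hp, rfl⟩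
  change s ∉ ptIdeal x p at hs
  have hs0 : s ≠ 0 := fun h => hs (h ▸ zero_mem _)
  have hc0 : c ≠ 0 := by
    rintro rfl
    rw [_root_.map_zero, mul_eq_zero, FaithfulSMul.algebraMap_eq_zero_iff] at hcs
    exact hcs.elim hk hs0
  obtain ⟨m, hm⟩ := hx.exists_associated c hc0
  obtain ⟨n, hn⟩ := hx.exists_associated s hs0
  rw [← mem_iff_of_associated hn, hx.mon_mem_ptIdeal zero_le] at hs
  have key : c * x b = u * x a * s := by
    apply hinj
    rw [map_mul, map_mul _ _ s, ← hcs, ← h]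
    ring
  have h2 : Associated (x (m + b)) (x (n + a)) := by
    rw [hx.map_add, hx.map_add]
    refine (hm.mul_right (x b)).trans ?_
    rw [key, mul_assoc]
    refine (associated_unit_mul_left _ _ u.isUnit).trans ?_
    rw [mul_comm]
    exact hn.symm.mul_right (x a)
  have h3 := (hx.associated_iff _ _).1 h2 p zero_le
  rw [val_add, val_add] at h3
  rcases hab.val p with h4 | h4
  · omega
  · exact h4

theorem isUnit_overring [IsDomain D] (hx : IsMonRing 0 x) {β : Ordinal.{u}} {b : Mon α}
    (hb : ∀ p : Vertex α, β ≤ p.height → val p b = 0) :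
    IsUnit (algebraMap D (overring (ptSet x β)) (x b)) := by
  have h0 : algebraMap D (FractionRing D) (x b) ≠ 0 := by
    rw [Ne, FaithfulSMul.algebraMap_eq_zero_iff]
    exact hx.ne_zero b
  have hmem : (algebraMap D (FractionRing D) (x b))⁻¹ ∈ overring (ptSet x β) := by
    rw [mem_overring_iff]
    rintro M ⟨p, hp, hM⟩
    refine ⟨1, x b, ?_, by rw [inv_mul_cancel₀ h0, map_one]⟩
    rw [hM, hx.mon_mem_ptIdeal zero_le, hb p hp]
    exact lt_irrefl _
  exact IsUnit.of_mul_eq_one ⟨_, hmem⟩ (Subtype.ext (mul_inv_cancel₀ h0))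

/-- The denominator of a reduced fraction in `T_β` has value zero at all points that count, hence is
a unit there; the fraction is associated to its numerator. -/
theorem overring_isMonRing [IsDomain D] (hx : IsMonRing 0 x) (β : Ordinal.{u}) :
    IsMonRing β fun m => algebraMap D (overring (ptSet x β)) (x m) where
  map_zero := by rw [hx.map_zero, map_one]
  map_add m n := by rw [hx.map_add, map_mul]
  ne_zero m h := hx.ne_zero m (FaithfulSMul.algebraMap_injective D (FractionRing D)
    ((congrArg Subtype.val h).trans (_root_.map_zero _).symm))
  exists_associated := by
    rintro ⟨t, htT⟩ ht
    have ht0 : t ≠ 0 := fun h => ht (Subtype.ext h)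
    obtain ⟨u, a, b, hab, h⟩ := hx.exists_reduced ht0
    have hb := hx.isUnit_overring (β := β) fun p hp => hx.val_eq_zero_of_mem ht0 htT hab h hp
    have h' : (⟨t, htT⟩ : overring (ptSet x β)) * algebraMap D _ (x b) =
        algebraMap D _ (u * x a) := Subtype.ext h
    refine ⟨a, ?_⟩
    have h1 := associated_mul_unit_left (⟨t, htT⟩ : overring (ptSet x β)) _ hb
    rw [h', map_mul] at h1
    exact (associated_unit_mul_left _ _ (u.isUnit.map (algebraMap D _))).symm.trans h1
  isCoprime m n h := (hx.isCoprime m n h).map _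
  dvd_iff m n := by
    constructor
    · rintro ⟨⟨t, htT⟩, h⟩ p hp
      have h1 : algebraMap D (FractionRing D) (x n) = algebraMap D _ (x m) * t :=
        congrArg Subtype.val h
      have ht0 : t ≠ 0 := by
        rintro rfl
        rw [mul_zero, FaithfulSMul.algebraMap_eq_zero_iff] at h1
        exact hx.ne_zero n h1
      obtain ⟨u, a, b, hab, hu⟩ := hx.exists_reduced ht0
      have hb := hx.val_eq_zero_of_mem ht0 htT hab hu hp
      have h2 : x (n + b) = u * x (m + a) := by
        apply FaithfulSMul.algebraMap_injective D (FractionRing D)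
        rw [hx.map_add, map_mul, h1, mul_assoc, hu, ← map_mul, hx.map_add]
        congr 1
        ring
      have h3 : Associated (x (n + b)) (x (m + a)) := by
        rw [h2]
        exact associated_unit_mul_left _ _ u.isUnit
      have h4 := (hx.associated_iff _ _).1 h3 p zero_le
      rw [val_add, val_add, hb] at h4
      omega
    · intro h
      obtain ⟨d, a, b, rfl, rfl, hd, -⟩ := exists_gcd m n
      have ha : IsUnit (algebraMap D (overring (ptSet x β)) (x a)) := by
        refine hx.isUnit_overring fun p hp => ?_
        have h1 := h p hp
        rw [val_add, val_add] at h1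
        rcases hd.val p with h2 | h2 <;> omega
      rw [hx.map_add, hx.map_add, map_mul, map_mul]
      exact mul_dvd_mul_left _ (ha.dvd)

theorem map_ptIdeal (p : Vertex α) {T : Type w} [CommRing T] (f : D →+* T) :
    (ptIdeal x p).map f = ptIdeal (fun m => f (x m)) p := by
  rw [ptIdeal, Ideal.map_span, ptIdeal]
  congr 1
  ext t
  constructor
  · rintro ⟨_, ⟨v, hv, rfl⟩, rfl⟩
    exact ⟨v, hv, rfl⟩
  · rintro ⟨v, hv, rfl⟩
    exact ⟨_, ⟨v, hv, rfl⟩, rfl⟩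

theorem critSet_eq [IsDomain D] (hx : IsMonRing 0 x) (hα : 0 < α) (β : Ordinal.{u}) :
    critSet D β = ptSet x β := by
  induction β using Ordinal.limitRecOn with
  | zero =>
    rw [critSet, Ordinal.limitRecOn_zero]
    refine (Set.eq_univ_of_forall fun M => ?_).symm
    have := M.isMaximal
    obtain ⟨p, hp⟩ := hx.exists_eq_ptIdeal hα M.asIdeal
    exact ⟨p, zero_le, hp⟩
  | add_one β ih =>
    have h1 : critSet D (β + 1) = {P | IsCritical (P.asIdeal.map
        (algebraMap D (overring (critSet D β))))} := by
      rw [critSet, Ordinal.limitRecOn_add_one]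
      rfl
    rw [h1, ih]
    have hT := hx.overring_isMonRing β
    ext P
    have := P.isMaximal
    obtain ⟨p, hp⟩ := hx.exists_eq_ptIdeal hα P.asIdeal
    have h2 : P ∈ ptSet x (β + 1) ↔ β < p.height := by
      rw [← Order.add_one_le_iff]
      constructor
      · rintro ⟨q, hq, hPq⟩
        rwa [(hx.samePt_of_ptIdeal_eq (hp.symm.trans hPq)).1]
      · exact fun h => ⟨p, h, hp⟩
    rw [h2, Set.mem_ofPred_eq, hp, map_ptIdeal]
    by_cases hβ : β ≤ p.height
    · exact hT.isCritical_ptIdeal_iff hβ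
    -- If `p` lies below `β`, its vertex is a unit in `T_β`, so `P` extends to the whole ring.
    · refine iff_of_false (fun h => h.1.ne_top ?_) fun h => hβ h.le
      refine Ideal.eq_top_of_isUnit_mem _ (Ideal.subset_span ⟨p, SamePt.refl p, rfl⟩)
        (hx.isUnit_overring fun q hq => ?_)
      rcases val_mon_eq_zero_or q p with h | h | h
      · exact h
      · exact absurd (hq.trans h.le) hβ
      · exact absurd (hq.trans h.1.le) hβ
  | limit β hl ih =>
    have h1 : critSet D β = ⋂ (γ : Ordinal.{u}) (_ : γ < β), critSet D γ := by
      rw [critSet, Ordinal.limitRecOn_limit _ _ _ _ hl]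
      rfl
    rw [h1]
    ext P
    simp only [Set.mem_iInter]
    constructor
    · intro h
      have := P.isMaximal
      obtain ⟨p, hp⟩ := hx.exists_eq_ptIdeal hα P.asIdeal
      refine ⟨p, ?_, hp⟩
      -- A point below the limit `β` is already lost at the stage following its height.
      by_contra! hlt
      have h2 := h (p.height + 1) (hl.add_one_lt hlt)
      rw [ih _ (hl.add_one_lt hlt)] at h2
      obtain ⟨q, hq, hPq⟩ := h2
      rw [← (hx.samePt_of_ptIdeal_eq (hp.symm.trans hPq)).1] at hq
      exact (lt_add_one _).not_ge hq
    · rintro ⟨p, hp, hP⟩ γ hγ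
      rw [ih γ hγ]
      exact ⟨p, hγ.le.trans hp, hP⟩

theorem isSPRank [IsDomain D] (hx : IsMonRing 0 x) (hα : 0 < α) : IsSPRank D α := by
  constructor
  · rw [Set.mem_ofPred_eq, hx.critSet_eq hα, Set.eq_empty_iff_forall_notMem]
    rintro P ⟨p, hp, -⟩
    exact p.height_lt.not_ge hp
  · intro β hβ
    rw [Set.mem_ofPred_eq, hx.critSet_eq hα, Set.eq_empty_iff_forall_notMem] at hβ
    by_contra! hlt
    let p : Vertex α := mkVertex β hlt 0 (IsParam.zero β) 0 (zero_mem_U _)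
    exact hβ ⟨ptIdeal x p, hx.ptIdeal_isMaximal zero_le⟩ ⟨p, le_rfl, rfl⟩

/-- Transport along an isomorphism of rings. -/
theorem ringEquiv {β : Ordinal.{u}} (hx : IsMonRing β x) {T : Type v} [CommRing T] (e : D ≃+* T) :
    IsMonRing β fun m => e (x m) where
  map_zero := by rw [hx.map_zero, map_one]
  map_add m n := by rw [hx.map_add, map_mul]
  ne_zero m h := hx.ne_zero m ((map_eq_zero_iff e e.injective).1 h)
  exists_associated t ht := by
    obtain ⟨m, hm⟩ := hx.exists_associated (e.symm t)
      fun h => ht ((map_eq_zero_iff e.symm e.symm.injective).1 h)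
    refine ⟨m, ?_⟩
    have := hm.map e
    rwa [e.apply_symm_apply] at this
  isCoprime m n h := (hx.isCoprime m n h).map e.toRingHom
  dvd_iff m n := by rw [← hx.dvd_iff, map_dvd_iff e]

end IsMonRing

end Overring

/- ### The monoid algebra and its localization -/

section Algebra

variable {α : Ordinal.{u}} {F : Type v} [Field F]

/-- The monoid embeds in a power of `ℕ`, which has unique sums; this rules out zero divisors. -/
instance : IsDomain (FX α F) := by
  have : TwoUniqueSums (Mon α) := TwoUniqueSums.of_injective_addHom
    ((Mon α).subtype : Mon α →ₙ+ (U α 0 → ℕ)) Subtype.val_injective inferInstance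
  have : NoZeroDivisors (FX α F) := inferInstance
  exact NoZeroDivisors.to_isDomain _

theorem monomial_zero : monomial α F 0 = 1 := rfl

theorem monomial_add (m n : Mon α) : monomial α F (m + n) = monomial α F m * monomial α F n := by
  rw [monomial, monomial, monomial, AddMonoidAlgebra.single_mul_single, mul_one]

theorem monomial_ne_zero (m : Mon α) : monomial α F m ≠ 0 :=
  AddMonoidAlgebra.single_ne_zero.2 one_ne_zero

theorem monomial_dvd_iff {m : Mon α} {f : FX α F} :
    monomial α F m ∣ f ↔ ∀ n, f.coeff n ≠ 0 → m.1 ≤ n.1 := by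
  have h : monomial α F m = AddMonoidAlgebra.of' F (Mon α) m := rfl
  rw [h, AddMonoidAlgebra.of'_dvd_iff_modOf_eq_zero]
  constructor
  · intro h n hn
    by_contra hle
    apply hn
    rw [← AddMonoidAlgebra.coeff_modOf_of_not_exists_add f m n, h]
    · rfl
    · rintro ⟨a, rfl⟩
      exact hle (le_mon_add_right _ _)
  · intro h
    ext n
    by_cases hn : ∃ a, n = m + a
    · rw [AddMonoidAlgebra.coeff_modOf_of_exists_add _ _ _ hn]
      rfl
    · rw [AddMonoidAlgebra.coeff_modOf_of_not_exists_add _ _ _ hn]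
      by_contra h'
      exact hn (exists_add_of_le (h n h'))

/-- Greatest common divisors of finitely many monomials. -/
theorem exists_inf (s : Finset (Mon α)) (hs : s.Nonempty) :
    ∃ d : Mon α, (∀ n ∈ s, d.1 ≤ n.1) ∧ ∀ r, ∃ n ∈ s, n.1 r = d.1 r := by
  classical
  induction hs using Finset.Nonempty.cons_induction with
  | singleton n =>
    exact ⟨n, fun m hm => by rw [Finset.mem_singleton.1 hm],
      fun r => ⟨n, Finset.mem_singleton_self n, rfl⟩⟩
  | cons n s hn hs ih =>
    obtain ⟨d, hd, hd'⟩ := ih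
    refine ⟨⟨n.1 ⊓ d.1, inf_mem n.2 d.2⟩, fun m hm => ?_, fun r => ?_⟩
    · rcases Finset.mem_cons.1 hm with rfl | hm
      · exact inf_le_left
      · exact inf_le_right.trans (hd m hm)
    · rcases le_total (n.1 r) (d.1 r) with h | h
      · exact ⟨n, Finset.mem_cons_self _ _, (min_eq_left h).symm⟩
      · obtain ⟨m, hm, hmr⟩ := hd' r
        exact ⟨m, Finset.mem_cons_of_mem hm, hmr.trans (min_eq_right h).symm⟩

theorem exists_eq_monomial_mul {f : FX α F} (hf : f ≠ 0) :
    ∃ (d : Mon α) (g : FX α F), f = monomial α F d * g ∧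
      ∀ r, ∃ n, g.coeff n ≠ 0 ∧ n.1 r = 0 := by
  have hs : f.coeff.support.Nonempty := by
    rw [Finsupp.support_nonempty_iff]
    exact fun h => hf (AddMonoidAlgebra.coeff_injective h)
  obtain ⟨d, hd, hd'⟩ := exists_inf _ hs
  obtain ⟨g, rfl⟩ := monomial_dvd_iff.2 fun n hn => hd n (Finsupp.mem_support_iff.2 hn)
  refine ⟨d, g, rfl, fun r => ?_⟩
  obtain ⟨n, hn, hnr⟩ := hd' r
  obtain ⟨a, rfl⟩ := exists_add_of_le (hd n hn)
  rw [Finsupp.mem_support_iff, monomial, AddMonoidAlgebra.coeff_single_mul_add, one_mul] at hn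
  refine ⟨a, hn, ?_⟩
  have : d.1 r + a.1 r = d.1 r := hnr
  omega

/-- Dividing by the gcd of the monomials that occur shows that `S` consists of the elements whose
monomials have gcd 1, a condition that can be tested at each indeterminate. -/
theorem mem_S_iff (hα : 0 < α) {f : FX α F} :
    f ∈ S α F ↔ ∀ r, ∃ n, f.coeff n ≠ 0 ∧ n.1 r = 0 := by
  constructor
  · intro h r
    have hf : f ≠ 0 := by
      rintro rfl
      refine h (baseVertex hα r).mon (fun h0 => ?_) (dvd_zero _)
      have h1 := (expo_baseVertex hα r r).2 rfl
      exact h1 (congrFun (congrArg Subtype.val h0) r)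
    obtain ⟨d, g, rfl, hg⟩ := exists_eq_monomial_mul hf
    have hd : d = 0 := by
      by_contra hd
      exact h d hd (dvd_mul_right _ _)
    rw [hd, monomial_zero, one_mul]
    exact hg r
  · intro h m hm hmf
    rw [monomial_dvd_iff] at hmf
    refine hm (Subtype.ext (funext fun r => ?_))
    obtain ⟨n, hn, hnr⟩ := h r
    exact Nat.le_zero.1 ((hmf n hn r).trans hnr.le)

open Classical in
/-- The projection to the subalgebra spanned by the monomials that do not involve `X_{0,r}`. -/
def killVar (F : Type v) [Field F] (r : U α 0) : FX α F →ₐ[F] FX α F :=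
  AddMonoidAlgebra.lift F (FX α F) (Mon α)
    { toFun := fun m => if m.toAdd.1 r = 0 then monomial α F m.toAdd else 0
      map_one' := if_pos rfl
      map_mul' := fun m n => by
        have h : (m * n).toAdd.1 r = m.toAdd.1 r + n.toAdd.1 r := rfl
        rw [h]
        by_cases hm : m.toAdd.1 r = 0
        · by_cases hn : n.toAdd.1 r = 0
          · rw [if_pos hm, if_pos hn, if_pos (by rw [hm, hn]), toAdd_mul, monomial_add]
          · rw [if_neg hn, mul_zero, if_neg (by omega)]
        · rw [if_neg hm, zero_mul, if_neg (by omega)] }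

open Classical in
theorem coeff_killVar (r : U α 0) (f : FX α F) (n : Mon α) :
    (killVar F r f).coeff n = if n.1 r = 0 then f.coeff n else 0 := by
  induction f using AddMonoidAlgebra.induction_linear with
  | zero => simp
  | add f g hf hg =>
    rw [map_add, AddMonoidAlgebra.coeff_add, Finsupp.add_apply, hf, hg,
      AddMonoidAlgebra.coeff_add, Finsupp.add_apply]
    split_ifs
    · rfl
    · exact add_zero 0
  | single m a =>
    have h : killVar F r (AddMonoidAlgebra.single m a) =
        a • (if m.1 r = 0 then monomial α F m else 0) :=
      AddMonoidAlgebra.lift_single _ _ _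
    rw [h, AddMonoidAlgebra.coeff_smul, Finsupp.smul_apply]
    by_cases hmn : m = n
    · subst hmn
      by_cases hm : m.1 r = 0
      · rw [if_pos hm, if_pos hm, monomial]
        simp
      · rw [if_neg hm, if_neg hm]
        simp
    · have h2 : (AddMonoidAlgebra.single m a : FX α F).coeff n = 0 := by
        rw [AddMonoidAlgebra.coeff_single, Finsupp.single_eq_of_ne (Ne.symm hmn)]
      rw [h2]
      by_cases hm : m.1 r = 0
      · rw [if_pos hm, monomial, AddMonoidAlgebra.coeff_single,
          Finsupp.single_eq_of_ne (Ne.symm hmn), smul_zero, ite_self]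
      · rw [if_neg hm]
        simp

theorem killVar_ne_zero_iff (r : U α 0) (f : FX α F) :
    killVar F r f ≠ 0 ↔ ∃ n, f.coeff n ≠ 0 ∧ n.1 r = 0 := by
  constructor
  · intro h
    by_contra! h'
    refine h (AddMonoidAlgebra.coeff_injective (Finsupp.ext fun n => ?_))
    rw [coeff_killVar]
    split_ifs with hn
    · by_contra hf
      exact h' n hf hn
    · rfl
  · rintro ⟨n, hn, hnr⟩ h
    have := coeff_killVar r f n
    rw [h, if_pos hnr] at this
    exact hn this.symm

/-- Gauss's lemma. -/
theorem closure_S (hα : 0 < α) : (Submonoid.closure (S α F) : Set (FX α F)) = S α F := by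
  refine Set.Subset.antisymm (fun f hf => ?_) Submonoid.subset_closure
  induction hf using Submonoid.closure_induction with
  | mem f hf => exact hf
  | one =>
    rw [mem_S_iff hα]
    refine fun r => ⟨0, ?_, rfl⟩
    rw [AddMonoidAlgebra.coeff_one_zero]
    exact one_ne_zero
  | mul f g _ _ hf hg =>
    -- Membership in `S` means a nonzero image under every `killVar`, and these are ring
    -- homomorphisms into a domain.
    simp only [mem_S_iff hα, ← killVar_ne_zero_iff] at *
    intro r
    rw [map_mul]
    exact mul_ne_zero (hf r) (hg r)

theorem closure_S_le (hα : 0 < α) : Submonoid.closure (S α F) ≤ nonZeroDivisors (FX α F) := by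
  intro f hf
  rw [← SetLike.mem_coe, closure_S hα, mem_S_iff hα] at hf
  obtain ⟨r⟩ : Nonempty (U α 0) := ⟨⟨0, zero_mem_U 0⟩⟩
  obtain ⟨n, hn, -⟩ := hf r
  rw [mem_nonZeroDivisors_iff_ne_zero]
  rintro rfl
  exact hn rfl

/-! ### Divisibility in the localization `D` -/

theorem isDomain_dom (hα : 0 < α) : IsDomain (Dom α F) :=
  IsLocalization.isDomain_localization (closure_S_le hα)

variable (F) in
/-- A monomial, as an element of `D`. -/
def monD (m : Mon α) : Dom α F := algebraMap (FX α F) (Dom α F) (monomial α F m)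

theorem monD_zero : monD F (0 : Mon α) = 1 := map_one _

theorem monD_add (m n : Mon α) : monD F (m + n) = monD F m * monD F n := by
  rw [monD, monomial_add, map_mul]; rfl

theorem monD_ne_zero (hα : 0 < α) (m : Mon α) : monD F m ≠ 0 := by
  intro h
  exact monomial_ne_zero m
    (IsLocalization.injective (Dom α F) (closure_S_le hα) (h.trans (map_zero _).symm))

theorem isUnit_of_mem_S {f : FX α F} (hf : f ∈ S α F) :
    IsUnit (algebraMap (FX α F) (Dom α F) f) :=
  IsLocalization.map_units (M := Submonoid.closure (S α F)) _
    ⟨f, Submonoid.subset_closure hf⟩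

theorem eq_zero_of_isUnit_monD (hα : 0 < α) {m : Mon α} (h : IsUnit (monD F m)) : m = 0 := by
  obtain ⟨t, ht⟩ := h.exists_right_inv
  obtain ⟨f, s, rfl⟩ := IsLocalization.exists_mk'_eq (Submonoid.closure (S α F)) t
  have ht' : algebraMap (FX α F) (Dom α F) (monomial α F m * f) = algebraMap _ _ (s : FX α F) := by
    rw [map_mul, ← IsLocalization.mk'_spec (Dom α F) f s, ← mul_assoc]
    change monD F m * _ * _ = _
    rw [ht, one_mul]
  have hs : (s : FX α F) ∈ S α F := (closure_S (F := F) hα).subset s.2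
  by_contra hm
  exact hs m hm ⟨f, (IsLocalization.injective (Dom α F) (closure_S_le hα) ht').symm⟩

theorem isCoprime_monD (hα : 0 < α) {m n : Mon α} (h : Disj m n) :
    IsCoprime (monD F m) (monD F n) := by
  -- The case `m = n` is separate because the sum below would be twice a monomial, which vanishes in
  -- characteristic 2.
  by_cases hmn : m = n
  · subst hmn
    rw [disj_self h, monD_zero]
    exact isCoprime_one_left
  -- No indeterminate occurs in both monomials, so the sum becomes a unit in `D`.
  have hS : monomial α F m + monomial α F n ∈ S α F := by
    rw [mem_S_iff hα]
    intro r
    have h1 : min (m.1 r) (n.1 r) = 0 := congrFun h r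
    rcases le_total (m.1 r) (n.1 r) with h2 | h2
    · refine ⟨m, ?_, (min_eq_left h2).symm.trans h1⟩
      rw [AddMonoidAlgebra.coeff_add, Finsupp.add_apply, monomial, monomial,
        AddMonoidAlgebra.coeff_single, AddMonoidAlgebra.coeff_single, Finsupp.single_eq_same,
        Finsupp.single_eq_of_ne hmn, add_zero]
      exact one_ne_zero
    · refine ⟨n, ?_, (min_eq_right h2).symm.trans h1⟩
      rw [AddMonoidAlgebra.coeff_add, Finsupp.add_apply, monomial, monomial,
        AddMonoidAlgebra.coeff_single, AddMonoidAlgebra.coeff_single, Finsupp.single_eq_same,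
        Finsupp.single_eq_of_ne (Ne.symm hmn), zero_add]
      exact one_ne_zero
  obtain ⟨t, ht⟩ := (isUnit_of_mem_S hS).exists_left_inv
  refine ⟨t, t, ?_⟩
  rw [← ht, map_add, mul_add]
  rfl

/-- Divisibility in `D` creates nothing new among monomials: after cancelling the gcd, the divisor
is coprime to its multiple, hence a unit, hence 1. -/
theorem isMonRing_monD (hα : 0 < α) : IsMonRing 0 (monD F : Mon α → Dom α F) where
  map_zero := monD_zero
  map_add := monD_add
  ne_zero := monD_ne_zero hα
  exists_associated t ht := by
    obtain ⟨f, s, rfl⟩ := IsLocalization.exists_mk'_eq (Submonoid.closure (S α F)) t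
    have hf : f ≠ 0 := by
      rintro rfl
      exact ht (IsLocalization.mk'_zero _)
    obtain ⟨d, g, rfl, hg⟩ := exists_eq_monomial_mul hf
    have hg := isUnit_of_mem_S ((mem_S_iff hα).2 hg)
    have hs := IsLocalization.map_units (Dom α F) s
    refine ⟨d, (associated_mul_unit_right (monD F d) _ hg).trans ?_⟩
    have h1 := IsLocalization.mk'_spec (Dom α F) (monomial α F d * g) s
    rw [map_mul] at h1
    rw [monD, ← h1]
    exact associated_mul_unit_left _ _ hs
  isCoprime _ _ := isCoprime_monD hα
  dvd_iff m n := by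
    have := isDomain_dom (F := F) hα
    constructor
    · intro h q _
      obtain ⟨d, a, b, rfl, rfl, hd, -⟩ := exists_gcd m n
      rw [monD_add, monD_add] at h
      have h1 := (mul_dvd_mul_iff_left (monD_ne_zero hα d)).1 h
      have h2 := eq_zero_of_isUnit_monD hα ((isCoprime_monD hα hd).isUnit_of_dvd h1)
      rw [h2, add_zero]
      exact val_mono q (le_mon_add_right _ _)
    · intro h
      obtain ⟨a, rfl⟩ := exists_add_of_le (le_of_val_le hα fun q => h q zero_le)
      rw [monD_add]
      exact dvd_mul_right _ _

/-- The generators in the definition are exactly the vertices at the point of `v`, the bounds on the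
components being those imposed by `U`. -/
theorem maxIdeal_eq (v : Vertex α) : maxIdeal F v = ptIdeal (monD F) v := by
  rw [maxIdeal, ptIdeal]
  congr 1
  ext t
  have key : ∀ {w : Vertex α}, SamePt w v →
      w.seq = tau v.height v.seq + Finsupp.single v.height w.param := by
    intro w hw
    ext δ
    rw [Finsupp.add_apply]
    rcases lt_trichotomy δ v.height with h | rfl | h
    · rw [tau_apply_of_le _ h.le, Finsupp.single_eq_of_ne h.ne, w.seq_of_lt (hw.1 ▸ h), add_zero]
    · rw [tau_apply_of_le _ le_rfl, Finsupp.single_eq_same, zero_add, Vertex.param, hw.1]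
    · rw [tau_apply_of_lt _ h, Finsupp.single_eq_of_ne h.ne', add_zero, hw.2 δ (hw.1 ▸ h)]
  have key' : ∀ {w : Vertex α} {a : Ordinal.{u}}, w.height = v.height →
      w.seq = tau v.height v.seq + Finsupp.single v.height a → SamePt w v := by
    intro w a hw h
    refine ⟨hw, fun δ hδ => ?_⟩
    rw [hw] at hδ
    rw [h, Finsupp.add_apply, tau_apply_of_lt _ hδ, Finsupp.single_eq_of_ne hδ.ne', add_zero]
  constructor
  · rintro ⟨w, rfl, hw, h⟩
    refine ⟨w, ?_, rfl⟩
    rcases h with ⟨-, h⟩ | ⟨-, i, h⟩ | ⟨-, γ, -, h⟩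
    · exact ⟨hw, fun δ _ => by rw [h]⟩
    · exact key' hw h
    · exact key' hw h
  · rintro ⟨w, hw, rfl⟩
    refine ⟨w, rfl, hw.1, ?_⟩
    have hp : IsParam v.height w.param := hw.1 ▸ w.isParam
    rcases zero_or_isSuccOrd_or_isSuccLimit v.height with h | h | h
    · refine Or.inl ⟨h, ?_⟩
      rw [hw.eq]
      rw [hp.1 h, v.isParam.1 h]
    · refine Or.inr (Or.inl ⟨h, ?_⟩)
      obtain ⟨i, hi⟩ := lt_omega0.1 (hp.2.1 h)
      exact ⟨i, hi ▸ key hw⟩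
    · exact Or.inr (Or.inr ⟨h, w.param, hp.2.2 h, key hw⟩)

/- Universe levels -/

/-- Sequences of ordinals live one universe up, but these have indices below `α` and bounded
components. So for small `F` the domain has a copy in `Type u`, as the corollary requires. -/
instance : Small.{u} (U α 0) := by
  refine small_of_injective (β := Set.Iio α → Set.Iio (max ω α))
    (f := fun t γ => ⟨t.1 γ, t.2.2.1 γ⟩) fun s t h => Subtype.ext (Finsupp.ext fun γ => ?_)
  by_cases hγ : γ < α
  · exact congrArg Subtype.val (congrFun h ⟨γ, hγ⟩)
  · have key : ∀ r : U α 0, r.1 γ = 0 := fun r => by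
      by_contra h0
      exact hγ (r.2.1 γ h0).2
    rw [key s, key t]

instance [Small.{u} F] : Small.{u} (FX α F) := small_map AddMonoidAlgebra.coeffEquiv

instance [Small.{u} F] : Small.{u} (Dom α F) :=
  small_of_surjective (f := fun p : FX α F × Submonoid.closure (S α F) =>
    IsLocalization.mk' (Dom α F) p.1 p.2) fun t => by
      obtain ⟨f, s, h⟩ := IsLocalization.exists_mk'_eq (Submonoid.closure (S α F)) t
      exact ⟨(f, s), h⟩

end Algebra

theorem asIdeal_image_critSet {α : Ordinal.{u}} {F : Type v} [Field F] (hα : 0 < α)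
    (β : Ordinal.{u}) : MaximalSpectrum.asIdeal '' critSet (Dom α F) β =
      {I | ∃ w : Vertex α, β ≤ w.height ∧ I = maxIdeal F w} := by
  have := isDomain_dom (F := F) hα
  have hx := isMonRing_monD (F := F) hα
  rw [hx.critSet_eq hα]
  ext I
  constructor
  · rintro ⟨P, ⟨p, hp, hP⟩, rfl⟩
    exact ⟨p, hp, hP.trans (maxIdeal_eq p).symm⟩
  · rintro ⟨p, hp, rfl⟩
    exact ⟨⟨maxIdeal F p, maxIdeal_eq (F := F) p ▸ hx.ptIdeal_isMaximal zero_le⟩,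
      ⟨p, hp, maxIdeal_eq p⟩, rfl⟩

end AlmostDedekind

end

theorem mainTheorem1 :
    (∀ (α : Ordinal.{u}), 0 < α → ∀ (F : Type v) [Field F],
      (Submonoid.closure (AlmostDedekind.S α F) : Set (AlmostDedekind.FX α F)) =
        AlmostDedekind.S α F ∧
      AlmostDedekind.IsAlmostDedekindDomain (AlmostDedekind.Dom α F) ∧
      AlmostDedekind.IsSPRank (AlmostDedekind.Dom α F) α ∧
      ∀ β : Ordinal.{u}, 1 ≤ β →
        MaximalSpectrum.asIdeal '' AlmostDedekind.critSet (AlmostDedekind.Dom α F) β =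
          {I | ∃ w : AlmostDedekind.Vertex α,
            β ≤ w.height ∧ I = AlmostDedekind.maxIdeal F w}) ∧
    (∀ α : Ordinal.{u}, 0 < α → ∃ (D : Type u) (_ : CommRing D),
      AlmostDedekind.IsAlmostDedekindDomain D ∧ AlmostDedekind.IsSPRank D α) := by
  constructor
  · intro α hα F _
    have := AlmostDedekind.isDomain_dom (F := F) hα
    have hx := AlmostDedekind.isMonRing_monD (F := F) hα
    exact ⟨AlmostDedekind.closure_S hα, hx.isAlmostDedekindDomain hα, hx.isSPRank hα,
      fun β _ => AlmostDedekind.asIdeal_image_critSet hα β⟩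
  · intro α hα
    have := AlmostDedekind.isDomain_dom (F := ℚ) hα
    -- Any small field serves; the structure is carried over to the copy of `D` in the lower
    -- universe.
    have hx := (AlmostDedekind.isMonRing_monD (F := ℚ) hα).ringEquiv
      (Shrink.ringEquiv.{u} (AlmostDedekind.Dom α ℚ)).symm
    exact ⟨Shrink.{u} (AlmostDedekind.Dom α ℚ), inferInstance, hx.isAlmostDedekindDomain hα,
      hx.isSPRank hα⟩
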